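/- Let $p$ be an odd prime, $n \ge 1$, and let $L/K$ be a cyclic Galois extension of degree $p^n$ with group $G = \langle\sigma\rangle$. Assume that $K$ has characteristic $0$ and contains a primitive $p^n$-th root of unity. \textbf{Notation.} A \emph{Hopf--Galois structure} on $L/K$ is a $K$-Hopf algebra $H$ together with an action of $H$ on $L$ making $L$ an $H$-module algebra such that the $K$-linear map $L\otimes_K H\to \mathrm{End}_K(L)$, $x\otimes h\mapsto (y\mapsto x\,h(y))$, is bijective. Two such structures $H_1,H_2$ are isomorphic if there is an isomorphism $\varphi:H_1\to H_2$ of $K$-Hopf algebras with $hx=\varphi(h)x$ for all $h\in H_1$, $x\in L$. Let $N=\langle\eta\rangle$ be a cyclic group of order $p^n$, and let $\delta$ be the $(p-1)$-st power of a generator of $\mathrm{Aut}(N)$. For an integer $s\ge 0$ let $\beta_s:G\to \mathrm{Hol}(N)\subseteq\mathrm{Perm}(N)$ be the homomorphism for which $\beta_s(\sigma)$ is the permutation $\mu\mapsto \delta^s(\mu)\,\eta^{-1}$ of $N$. The map $b_s:G\to N$, $g\mapsto \beta_s(g)(1)$, is a bijection; let $\alpha_s:N\to\mathrm{Perm}(G)$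 be the embedding $\alpha_s(\mu)=b_s^{-1}\circ\lambda(\mu)\circ b_s$, where $\lambda$ denotes left translation. Let $H_s=L[\alpha_s(N)]^G$ be the $K$-algebra of fixed points of the group algebra $L[\alpha_s(N)]$ under the action of $G$ as Galois automorphisms on $L$ and by $g*\pi=\lambda(g)\pi\lambda(g)^{-1}$ on $\alpha_s(N)$. (Since $\delta$ has order $p^{n-1}$, $H_s$ depends only on $s$ modulo $p^{n-1}$; in particular $H_{p^{n-1}}=H_0$.) Let $v_p$ be the $p$-adic valuation, with $v_p(0)=\infty$, and let $\varphi$ be Euler's function. \textbf{Statement.} \begin{enumerate} \item For $0\le r,s<p^{n-1}$, $H_r\cong H_s$ as $K$-algebras if and only if $v_p(r)=v_p(s)$. \item The underlying $K$-algebras of the Hopf--Galois structures on $L/K$ form precisely $n$ isomorphism classes of $K$-algebras. \item For each $0\le v\le n-1$, there are precisely $\varphi(p^{n-1-v})$ isomorphism classes of Hopf--Galois structures on $L/K$ whose underlying $K$-algebra is isomorphic to $H_{p^v}$. \end{enumerate} -/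

import Mathlib

open scoped TensorProduct

universe u v w

/-! ### Hopf-Galois structures on a field extension -/

/-- A Hopf-Galois structure on `L/K`: a `K`-Hopf algebra `H` together with an action of `H` on `L`
that makes `L` an `H`-module algebra and for which the `K`-linear map
`L ⊗ H → End_K(L)`, `x ⊗ h ↦ (y ↦ x * (h y))`, is bijective.
(For a finite extension such an `H` embeds in `End_K(L)`, so taking `H` in the universe
of `L` loses nothing up to isomorphism.) -/
structure HopfGaloisStructure (K : Type u) (L : Type v) [Field K] [Field L] [Algebra K L] where
  /-- The underlying Hopf algebra. -/
  H : Type v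
  [ring : Ring H]
  [hopf : HopfAlgebra K H]
  /-- The action of `H` on `L`. -/
  act : H →ₐ[K] Module.End K L
  /-- `h(1) = ε(h) 1`. -/
  act_one : ∀ h : H, act h 1 = algebraMap K L (Coalgebra.counit (R := K) h)
  /-- `h(x y) = ∑ h₁(x) h₂(y)`, where `Δ(h) = ∑ h₁ ⊗ h₂`. -/
  act_mul : ∀ (h : H) (x y : L),
    act h (x * y) =
      LinearMap.mul' K L
        (TensorProduct.map (act.toLinearMap.flip x) (act.toLinearMap.flip y)
          (Coalgebra.comul (R := K) h))
  bijective : Function.Bijective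
    (TensorProduct.lift
      ((LinearMap.mul K (Module.End K L)).compl₁₂ (Algebra.lmul K L).toLinearMap
        act.toLinearMap) : L ⊗[K] H →ₗ[K] Module.End K L)

attribute [instance] HopfGaloisStructure.ring HopfGaloisStructure.hopf

namespace HopfGaloisStructure

variable (K : Type u) (L : Type v) [Field K] [Field L] [Algebra K L]

/-- Isomorphism of Hopf-Galois structures: there is an isomorphism `φ : H₁ → H₂` of `K`-Hopf
algebras (a bialgebra isomorphism automatically commutes with the antipodes) such that
`h x = φ(h) x` for all `h ∈ H₁` and `x ∈ L`. -/
def isoSetoid : Setoid (HopfGaloisStructure K L) where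
  r S T := ∃ φ : S.H ≃ₐc[K] T.H, ∀ (h : S.H) (x : L), S.act h x = T.act (φ h) x
  iseqv :=
    { refl := fun S => ⟨BialgEquiv.refl K S.H, fun _ _ => rfl⟩
      symm := by
        rintro S T ⟨φ, hφ⟩
        refine ⟨φ.symm, fun h x => ?_⟩
        rw [hφ]
        congr 2
        exact (φ.toEquiv.apply_symm_apply h).symm
      trans := by
        rintro S T U ⟨φ, hφ⟩ ⟨ψ, hψ⟩
        exact ⟨φ.trans ψ, fun h x => (hφ h x).trans (hψ _ x)⟩ }

/-- Two Hopf-Galois structures are related if their underlying `K`-algebras are isomorphic. -/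
def algSetoid : Setoid (HopfGaloisStructure K L) where
  r S T := Nonempty (S.H ≃ₐ[K] T.H)
  iseqv :=
    { refl := fun _ => ⟨AlgEquiv.refl⟩
      symm := fun ⟨e⟩ => ⟨e.symm⟩
      trans := fun ⟨e⟩ ⟨f⟩ => ⟨e.trans f⟩ }

end HopfGaloisStructure

/-! ### The fixed rings `L[M]^G` -/

section FixedRing

variable (K : Type u) (L : Type v) [Field K] [Field L] [Algebra K L]

/-- The left regular embedding `λ : G → Perm(G)`. -/
def leftRegular (G : Type w) [Group G] : G →* Equiv.Perm G := MulAction.toPermHom G G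

/-- The action of `g ∈ G = Gal(L/K)` on the group algebra `L[Perm(G)]`: as a Galois automorphism
on the coefficients and by `π ↦ λ(g) π λ(g)⁻¹` on the group elements. -/
noncomputable def galoisConjAction (g : Gal(L/K)) :
    MonoidAlgebra L (Equiv.Perm Gal(L/K)) →ₐ[K] MonoidAlgebra L (Equiv.Perm Gal(L/K)) :=
  (MonoidAlgebra.mapDomainAlgHom K L
      (MulAut.conj (leftRegular Gal(L/K) g)).toMonoidHom).comp
    (MonoidAlgebra.mapAlgHom (Equiv.Perm Gal(L/K)) g.toAlgHom)

/-- The `K`-algebra `L[M]^G` for a subgroup `M` of `Perm(G)`, `G = Gal(L/K)`: the elements of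
`L[M] ⊆ L[Perm(G)]` that are fixed by every `g ∈ G`. -/
noncomputable def fixedGroupAlgebra (M : Subgroup (Equiv.Perm Gal(L/K))) :
    Subalgebra K (MonoidAlgebra L (Equiv.Perm Gal(L/K))) :=
  (MonoidAlgebra.mapDomainAlgHom K L M.subtype).range ⊓
    ⨅ g : Gal(L/K), AlgHom.equalizer (galoisConjAction K L g) (AlgHom.id K _)

end FixedRing

/-! ### Byott's translation -/

section Byott

variable {G : Type v} {N : Type w} [Group G] [Group N]

/-- For `β : G → Perm(N)` such that `b : g ↦ β(g)(1)` is a bijection `G → N`, the corresponding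
embedding `α : N → Perm(G)`, `α(μ) = b⁻¹ ∘ λ(μ) ∘ b`. -/
noncomputable def byottEmbedding (β : G →* Equiv.Perm N)
    (hβ : Function.Bijective fun g : G => β g 1) : N →* Equiv.Perm G :=
  (Equiv.ofBijective _ hβ).symm.permCongrHom.toMonoidHom.comp (leftRegular N)

/-- The element `(ρ(η), δ)` of `Hol(N) = ρ(N) ⋊ Aut(N)` as a permutation of `N`:
`μ ↦ δ(μ) η⁻¹`, where `ρ(η)(μ) = μ η⁻¹`. -/
def holElement (η : N) (δ : MulAut N) : Equiv.Perm N :=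
  Equiv.mulRight η⁻¹ * MulAut.toPerm N δ

end Byott

/-- The choices that index the Hopf-Galois structures on a cyclic extension of degree `p ^ n`:
`p` is an odd prime, `n ≥ 1`, `G` and `N` are cyclic of order `p ^ n` with generators `σ` and `η`,
and `θ` is a generator of `Aut(N)`. -/
structure CyclicChoice (p n : ℕ) (G : Type v) (N : Type w) [Group G] [Group N] where
  prime : p.Prime
  odd : Odd p
  pos : 0 < n
  card_G : Nat.card G = p ^ n
  card_N : Nat.card N = p ^ n
  σ : G
  σ_gen : ∀ g : G, g ∈ Subgroup.zpowers σ
  η : N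
  η_gen : ∀ μ : N, μ ∈ Subgroup.zpowers η
  θ : MulAut N
  θ_gen : ∀ a : MulAut N, a ∈ Subgroup.zpowers θ

theorem emultiplicity_geom_sum_of_dvd_sub_one {p : ℕ} (hp : p.Prime) (hodd : Odd p) {x : ℤ}
    (hx : (p : ℤ) ∣ x - 1) (m : ℕ) :
    emultiplicity (p : ℤ) (∑ i ∈ Finset.range m, x ^ i) = emultiplicity p m := by
  have hpp : Prime (p : ℤ) := Nat.prime_iff_prime_int.mp hp
  by_cases h1 : x = 1
  · subst h1
    simp [Int.natCast_emultiplicity]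
  have hx' : ¬ (p : ℤ) ∣ x := fun h => by
    have : (p : ℤ) ∣ 1 := by simpa using dvd_sub h hx
    exact hpp.not_dvd_one this
  have h := Int.emultiplicity_pow_sub_pow hp hodd (y := 1) hx hx' m
  rw [one_pow, ← geom_sum_mul, emultiplicity_mul hpp, add_comm] at h
  have hfin : FiniteMultiplicity (p : ℤ) (x - 1) :=
    FiniteMultiplicity.of_prime_left hpp (sub_ne_zero.mpr h1)
  exact WithTop.add_left_cancel (finiteMultiplicity_iff_emultiplicity_ne_top.mp hfin) h

theorem prime_pow_dvd_geom_sum_iff {p : ℕ} (hp : p.Prime) (hodd : Odd p) {x : ℤ}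
    (hx : (p : ℤ) ∣ x - 1) (n m : ℕ) :
    ((p ^ n : ℕ) : ℤ) ∣ ∑ i ∈ Finset.range m, x ^ i ↔ p ^ n ∣ m := by
  rw [Nat.cast_pow, pow_dvd_iff_le_emultiplicity, pow_dvd_iff_le_emultiplicity,
    emultiplicity_geom_sum_of_dvd_sub_one hp hodd hx]

namespace CyclicChoice

variable {p n : ℕ} {G : Type v} {N : Type w} [Group G] [Group N] (D : CyclicChoice p n G N)

/-- `δ` is the `(p - 1)`-st power of the chosen generator of `Aut(N)`. -/
def δ : MulAut N := D.θ ^ (p - 1)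

/-- `π_s = (ρ(η), δ ^ s)`. -/
def π (s : ℕ) : Equiv.Perm N := holElement D.η (D.δ ^ s)

theorem orderOf_η : orderOf D.η = p ^ n := by
  rw [orderOf_eq_card_of_forall_mem_zpowers D.η_gen, D.card_N]

theorem orderOf_σ : orderOf D.σ = p ^ n := by
  rw [orderOf_eq_card_of_forall_mem_zpowers D.σ_gen, D.card_G]

theorem exists_exponent (s : ℕ) :
    ∃ x : ℤ, (p : ℤ) ∣ x - 1 ∧ (D.δ ^ s) D.η = D.η ^ x := by
  obtain ⟨t, ht⟩ := Subgroup.mem_zpowers_iff.mp (D.η_gen (D.θ D.η))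
  have hpow : ∀ k : ℕ, (D.θ ^ k) D.η = D.η ^ (t ^ k) := by
    intro k
    induction k with
    | zero => simp
    | succ k ih =>
      rw [pow_succ, MulAut.mul_apply, ← ht, map_zpow, ih, ← zpow_mul, pow_succ]
  have htp : IsCoprime t (p : ℤ) := by
    rw [isCoprime_comm, Prime.coprime_iff_not_dvd (Nat.prime_iff_prime_int.mp D.prime)]
    rintro ⟨c, rfl⟩
    have h1 : orderOf (D.θ D.η) = p ^ n := by
      rw [MulEquiv.orderOf_eq, D.orderOf_η]
    have h2 : (D.θ D.η) ^ (p ^ (n - 1)) = 1 := by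
      rw [← ht, ← zpow_natCast, ← zpow_mul, ← orderOf_dvd_iff_zpow_eq_one, D.orderOf_η]
      refine ⟨c, ?_⟩
      obtain ⟨k, rfl⟩ := Nat.exists_eq_succ_of_ne_zero D.pos.ne'
      push_cast [Nat.succ_eq_add_one, Nat.add_sub_cancel]
      ring
    have h3 := orderOf_dvd_of_pow_eq_one h2
    rw [h1, Nat.pow_dvd_pow_iff_le_right D.prime.one_lt] at h3
    have := D.pos
    omega
  refine ⟨t ^ ((p - 1) * s), ?_, ?_⟩
  · have hF := Int.ModEq.pow_card_sub_one_eq_one D.prime htp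
    have := (hF.pow s).symm.dvd
    rwa [one_pow, ← pow_mul] at this
  · rw [δ, ← pow_mul, hpow]

theorem π_pow_apply {s : ℕ} {x : ℤ} (hx : (D.δ ^ s) D.η = D.η ^ x) (m : ℕ) (k : ℤ) :
    (D.π s ^ m) (D.η ^ k) = D.η ^ (x ^ m * k - ∑ i ∈ Finset.range m, x ^ i) := by
  induction m with
  | zero => simp
  | succ m ih =>
    rw [pow_succ', Equiv.Perm.mul_apply, ih]
    change (D.δ ^ s) (D.η ^ _) * D.η⁻¹ = _
    rw [map_zpow, hx, ← zpow_mul, ← zpow_neg_one, ← zpow_add, geom_sum_succ]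
    congr 1
    ring

theorem orderOf_π_dvd (s : ℕ) : orderOf (D.π s) ∣ orderOf D.σ := by
  obtain ⟨x, hx1, hx⟩ := D.exists_exponent s
  rw [D.orderOf_σ]
  apply orderOf_dvd_of_pow_eq_one
  ext μ
  obtain ⟨k, rfl⟩ := Subgroup.mem_zpowers_iff.mp (D.η_gen μ)
  rw [D.π_pow_apply hx, Equiv.Perm.one_apply, zpow_eq_zpow_iff_modEq, D.orderOf_η]
  apply Int.ModEq.symm
  rw [Int.modEq_iff_dvd]
  have h := (prime_pow_dvd_geom_sum_iff D.prime D.odd hx1 n (p ^ n)).mpr dvd_rfl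
  have e : x ^ p ^ n * k - ∑ i ∈ Finset.range (p ^ n), x ^ i - k =
      (∑ i ∈ Finset.range (p ^ n), x ^ i) * ((x - 1) * k - 1) := by
    linear_combination (-k) * geom_sum_mul x (p ^ n)
  rw [e]
  exact h.mul_right _

/-- The homomorphism `β_s : G → Hol(N) ⊆ Perm(N)` with `β_s(σ) = (ρ(η), δ ^ s)`. -/
noncomputable def β (s : ℕ) : G →* Equiv.Perm N :=
  monoidHomOfForallMemZpowers D.σ_gen (D.orderOf_π_dvd s)

theorem β_σ (s : ℕ) : D.β s D.σ = D.π s :=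
  monoidHomOfForallMemZpowers_apply_gen D.σ_gen (D.orderOf_π_dvd s)

theorem β_bijective (s : ℕ) : Function.Bijective fun g : G => D.β s g 1 := by
  obtain ⟨x, hx1, hx⟩ := D.exists_exponent s
  have hpos : 0 < p ^ n := pow_pos D.prime.pos n
  have : Finite G := Nat.finite_of_card_ne_zero (by rw [D.card_G]; exact hpos.ne')
  have : Finite N := Nat.finite_of_card_ne_zero (by rw [D.card_N]; exact hpos.ne')
  have hval : ∀ m : ℕ, D.β s (D.σ ^ m) 1 = D.η ^ (-∑ i ∈ Finset.range m, x ^ i) := by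
    intro m
    have := D.π_pow_apply hx m 0
    rwa [zpow_zero, mul_zero, zero_sub, ← D.β_σ, ← map_pow] at this
  have key : ∀ a c : ℕ, D.β s (D.σ ^ a) 1 = D.β s (D.σ ^ (a + c)) 1 →
      D.σ ^ a = D.σ ^ (a + c) := by
    intro a c h
    rw [hval, hval, zpow_eq_zpow_iff_modEq, D.orderOf_η, Int.neg_modEq_neg,
      Int.modEq_iff_dvd] at h
    have e : ∑ i ∈ Finset.range (a + c), x ^ i - ∑ i ∈ Finset.range a, x ^ i =
        x ^ a * ∑ i ∈ Finset.range c, x ^ i := by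
      rw [Finset.sum_range_add, add_sub_cancel_left, Finset.mul_sum]
      simp only [pow_add]
    rw [e] at h
    have hcop : IsCoprime ((p ^ n : ℕ) : ℤ) (x ^ a) := by
      rw [Nat.cast_pow]
      apply IsCoprime.pow
      obtain ⟨c, hc⟩ := hx1
      exact ⟨-c, 1, by linear_combination hc⟩
    have h2 := (prime_pow_dvd_geom_sum_iff D.prime D.odd hx1 n c).mp (hcop.dvd_of_dvd_mul_left h)
    rw [← D.orderOf_σ] at h2
    rw [pow_add, orderOf_dvd_iff_pow_eq_one.mp h2, mul_one]
  have hinj : Function.Injective fun g : G => D.β s g 1 := by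
    intro g g' h
    obtain ⟨a, rfl⟩ := mem_powers_iff_mem_zpowers.mpr (D.σ_gen g)
    obtain ⟨c, rfl⟩ := mem_powers_iff_mem_zpowers.mpr (D.σ_gen g')
    change D.σ ^ a = D.σ ^ c
    replace h : D.β s (D.σ ^ a) 1 = D.β s (D.σ ^ c) 1 := h
    rcases le_total a c with hac | hac
    · obtain ⟨d, rfl⟩ := Nat.exists_eq_add_of_le hac
      exact key _ _ h
    · obtain ⟨d, rfl⟩ := Nat.exists_eq_add_of_le hac
      exact (key _ _ h.symm).symm
  exact (Nat.bijective_iff_injective_and_card _).mpr ⟨hinj, by rw [D.card_G, D.card_N]⟩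

/-- The embedding `α_s : N → Perm(G)` that corresponds to `β_s`. -/
noncomputable def α (s : ℕ) : N →* Equiv.Perm G :=
  byottEmbedding (D.β s) (D.β_bijective s)

end CyclicChoice

/-- `H_s = L[α_s(N)]^G` as a `K`-algebra, for `G = Gal(L/K)`. -/
noncomputable abbrev CyclicChoice.H {K : Type u} {L : Type v} [Field K] [Field L] [Algebra K L]
    {N : Type w} [Group N] {p n : ℕ} (D : CyclicChoice p n Gal(L/K) N) (s : ℕ) :
    Subalgebra K (MonoidAlgebra L (Equiv.Perm Gal(L/K))) :=
  fixedGroupAlgebra K L (D.α s).range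

/-! ### Linear algebra -/

/-! Let `H` be a Hopf-Galois structure. By Dedekind independence the elements of `G` form an
`L`-basis of `End_K(L) ≅ L ⊗ H`. An element of `L ⊗ H` is group-like exactly when it acts on `L` as
an automorphism, so there is a bijection `e` from `G` onto the group `N` of group-likes. The Galois
action on coefficients gives `a : G → Aut(N)` with `e(τg) = e(τ) · a_τ(e(g))`: a skew brace with
multiplicative group `G` (`HopfGaloisStructure.isBraceDatum`). Conversely, Galois descent of `L[N]`
along such a datum gives a Hopf-Galois structure (`IsBraceDatum.hopfGaloisStructure`).

For `G` cyclic of odd prime power order, `N` is generated by `e(σ)`: on the Frattini quotient, the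
images of `e(σ^k)` are partial geometric sums of a unipotent operator, and these cannot fill a space
of dimension at least 2 when `p` is odd (`eq_one_of_geom_orbit_surjective`). The structure is then
determined by the exponent `x` in `a_σ(e(σ)) = e(σ)^x`, taken modulo `p^n`, and `x ≡ 1` modulo `p`.
These are the exponents of the powers `δ^s`, `s < p^(n-1)`, so each structure corresponds to exactly
one `s`.

As algebras, `H_r ≅ H_s` exactly when `δ^r` and `δ^s` have the same order. If they do, they generate
the same subgroup. Because `K` contains the roots of unity, the Fourier transform turns `L[N]` into
functions on `K`-valued characters, and the fixed algebra depends only on how `σ` permutes the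
characters; permutations generating the same cyclic group are conjugate. Conversely, the kernel of
the action of `G` on `N` can be read off from the algebra homomorphisms `H → L` (`act_eq_one_iff`).
The order of `δ^s` is given by `gcd(p^(n-1), s)`, and counting the `s` with a given gcd yields the
totients. -/

theorem LinearIndependent.bijective_dotProduct {ι κ F : Type*} [Field F] [Fintype ι] [Fintype κ]
    {a : ι → κ → F} (ha : LinearIndependent F a) (hcard : Nat.card ι = Nat.card κ) :
    Function.Bijective fun (y : κ → F) (i : ι) => ∑ k, a i k * y k := by
  classical
  have hrow : LinearIndependent F (Matrix.of a).row := ha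
  let T : (κ → F) →ₗ[F] (ι → F) := (Matrix.of a).mulVecLin
  have hT : (T : (κ → F) → ι → F) = fun y i => ∑ k, a i k * y k := by
    ext y i
    simp [T, Matrix.mulVec, dotProduct]
  have hfr : Module.finrank F (κ → F) = Module.finrank F (ι → F) := by
    simpa [Nat.card_eq_fintype_card] using hcard.symm
  have hsurj : Function.Surjective T := by
    rw [← LinearMap.range_eq_top]
    apply Submodule.eq_top_of_finrank_eq
    have := hrow.rank_matrix
    rw [Module.finrank_fintype_fun_eq_card]
    exact this
  rw [← hT]
  exact ⟨(LinearMap.injective_iff_surjective_of_finrank_eq_finrank hfr).mpr hsurj, hsurj⟩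

/-! ### Dedekind independence, dual systems and traces. -/

section Galois

variable (K : Type u) (L : Type v) [Field K] [Field L] [Algebra K L] [FiniteDimensional K L]

theorem AlgEquiv.linearIndependent_toLinearMap :
    LinearIndependent L (fun g : Gal(L/K) => (g.toLinearMap : Module.End K L)) := by
  have h := _root_.linearIndependent_toLinearMap K L L
  exact h.comp (fun g : Gal(L/K) => (g : L →ₐ[K] L)) (fun g g' h => by
    ext x; exact DFunLike.congr_fun h x)

/-- The automorphisms of a finite Galois extension `L/K` as an `L`-basis of `End_K(L)`. -/
noncomputable def galoisBasis [IsGalois K L] : Module.Basis Gal(L/K) L (Module.End K L) :=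
  basisOfLinearIndependentOfCardEqFinrank (AlgEquiv.linearIndependent_toLinearMap K L) (by
    rw [Module.finrank_linearMap_self, ← IsGalois.card_aut_eq_finrank, Nat.card_eq_fintype_card])

@[simp] theorem galoisBasis_apply [IsGalois K L] (g : Gal(L/K)) :
    galoisBasis K L g = g.toLinearMap := by
  simp [galoisBasis]

-- By Dedekind independence the matrix `(g (b i))`, for a `K`-basis `b` of `L`, is invertible, so
-- the system for `x` can be solved. These dual elements make Galois descent explicit below.
open scoped Classical in
theorem exists_galois_dual [IsGalois K L] : ∃ (m : ℕ) (x y : Fin m → L),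
    ∀ g : Gal(L/K), ∑ i, x i * g (y i) = if g = 1 then 1 else 0 := by
  classical
  let b := Module.finBasis K L
  have hli : LinearIndependent L (fun (g : Gal(L/K)) i => g (b i)) := by
    rw [Fintype.linearIndependent_iff]
    intro c hc
    refine Fintype.linearIndependent_iff.mp (AlgEquiv.linearIndependent_toLinearMap K L) c ?_
    refine b.ext fun i => ?_
    have := congrFun hc i
    simpa [Finset.sum_apply] using this
  obtain ⟨x, hx⟩ := (hli.bijective_dotProduct (by
    rw [IsGalois.card_aut_eq_finrank, Nat.card_eq_fintype_card, Fintype.card_fin])).2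
    (fun g => if g = 1 then 1 else 0)
  exact ⟨_, x, b, fun g => by simpa [mul_comm] using congrFun hx g⟩

variable {K L}

theorem algebraMap_of_forall_galois_fixed [IsGalois K L] {c : L}
    (h : ∀ g : Gal(L/K), g c = c) : ∃ d : K, algebraMap K L d = c :=
  (IsGalois.mem_range_algebraMap_iff_fixed c).mpr h

theorem exists_sum_galois_eq [IsGalois K L] (c : L) :
    ∃ d : K, algebraMap K L d = ∑ g : Gal(L/K), g c := by
  refine algebraMap_of_forall_galois_fixed fun h => ?_
  rw [map_sum]
  exact Fintype.sum_equiv (Equiv.mulLeft h) _ _ fun g => rfl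

theorem exists_sum_galois_eq_one [CharZero K] [IsGalois K L] :
    ∃ z : L, ∑ g : Gal(L/K), g z = 1 := by
  refine ⟨algebraMap K L (Nat.card Gal(L/K) : K)⁻¹, ?_⟩
  simp only [AlgEquiv.commutes, Finset.sum_const, Finset.card_univ, nsmul_eq_mul]
  rw [← Nat.card_eq_fintype_card, ← map_natCast (algebraMap K L), ← map_mul,
    mul_inv_cancel₀ (Nat.cast_ne_zero.mpr Nat.card_pos.ne'), map_one]

end Galois

/-! ### Descent of Hopf algebras -/

section HopfDescent

variable {K : Type u} {L : Type v} [Field K] [Field L] [Algebra K L]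

theorem LinearMap.injective_of_linearIndependent_basis {ι V W : Type*} [AddCommGroup V] [Module K V]
    [AddCommGroup W] [Module K W] (b : Module.Basis ι K V) (f : V →ₗ[K] W)
    (h : LinearIndependent K fun i => f (b i)) : Function.Injective f := by
  rw [← LinearMap.ker_eq_bot, LinearMap.ker_eq_bot']
  intro m hm
  rw [← b.linearCombination_repr m] at hm ⊢
  rw [Finsupp.apply_linearCombination] at hm
  have := linearIndependent_iff.mp h _ hm
  rw [this, map_zero]

/-- The natural map `V ⊗_K V' → W ⊗_L W'` attached to `K`-linear maps `V → W` and `V' → W'`. -/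
noncomputable def descentMap {V V' W W' : Type*} [AddCommGroup V] [Module K V]
    [AddCommGroup V'] [Module K V'] [AddCommGroup W] [Module K W] [Module L W] [IsScalarTower K L W]
    [AddCommGroup W'] [Module K W'] [Module L W'] [IsScalarTower K L W']
    (f : V →ₗ[K] W) (g : V' →ₗ[K] W') : V ⊗[K] V' →ₗ[K] W ⊗[L] W' :=
  TensorProduct.lift (LinearMap.mk₂ K (fun x y => f x ⊗ₜ[L] g y)
    (fun _ _ _ => by rw [map_add, TensorProduct.add_tmul])
    (fun c x y => by rw [map_smul, ← TensorProduct.smul_tmul'])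
    (fun _ _ _ => by rw [map_add, TensorProduct.tmul_add])
    (fun c x y => by rw [map_smul, TensorProduct.tmul_smul]))

section

variable {V V' W W' : Type*} [AddCommGroup V] [Module K V]
    [AddCommGroup V'] [Module K V'] [AddCommGroup W] [Module K W] [Module L W] [IsScalarTower K L W]
    [AddCommGroup W'] [Module K W'] [Module L W'] [IsScalarTower K L W']

@[simp] theorem descentMap_tmul (f : V →ₗ[K] W) (g : V' →ₗ[K] W') (x : V) (y : V') :
    descentMap (L := L) f g (x ⊗ₜ y) = f x ⊗ₜ g y := rfl

theorem linearIndependent_descentMap {ι κ : Type*} {f : V →ₗ[K] W} {g : V' →ₗ[K] W'}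
    {b : Module.Basis ι K V} {c : Module.Basis κ K V'} (hb : LinearIndependent L fun i => f (b i))
    (hc : LinearIndependent L fun i => g (c i)) :
    LinearIndependent L fun i => descentMap (L := L) f g (b.tensorProduct c i) := by
  have h := hb.tmul_of_isDomain hc
  have e : (fun i => descentMap (L := L) f g (b.tensorProduct c i)) =
      fun i : ι × κ => f (b i.1) ⊗ₜ[L] g (c i.2) := by
    funext i
    rw [Module.Basis.tensorProduct_apply', descentMap_tmul]
  rw [e]
  exact h

theorem injective_descentMap_of_linearIndependent {ι κ : Type*} {f : V →ₗ[K] W} {g : V' →ₗ[K] W'}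
    {b : Module.Basis ι K V} {c : Module.Basis κ K V'} (hb : LinearIndependent L fun i => f (b i))
    (hc : LinearIndependent L fun i => g (c i)) :
    Function.Injective (descentMap (L := L) f g) :=
  LinearMap.injective_of_linearIndependent_basis (b.tensorProduct c) _
    ((linearIndependent_descentMap hb hc).restrict_scalars' K)

end

/-- The factorization of a linear map through an injective linear map. -/
noncomputable def LinearMap.liftInjective {U V W : Type*} [AddCommGroup U] [Module K U]
    [AddCommGroup V] [Module K V] [AddCommGroup W] [Module K W] (j : V →ₗ[K] W)
    (hj : Function.Injective j) (g : U →ₗ[K] W) (hg : ∀ u, ∃ v, j v = g u) : U →ₗ[K] V :=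
  (LinearEquiv.ofInjective j hj).symm.toLinearMap ∘ₗ g.codRestrict (LinearMap.range j) hg

@[simp] theorem LinearMap.apply_liftInjective {U V W : Type*} [AddCommGroup U] [Module K U]
    [AddCommGroup V] [Module K V] [AddCommGroup W] [Module K W] (j : V →ₗ[K] W)
    (hj : Function.Injective j) (g : U →ₗ[K] W) (hg : ∀ u, ∃ v, j v = g u) (u : U) :
    j (LinearMap.liftInjective j hj g hg u) = g u := by
  have := LinearEquiv.ofInjective_apply (h := hj) j
    ((LinearEquiv.ofInjective j hj).symm (g.codRestrict (LinearMap.range j) hg u))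
  rw [LinearEquiv.apply_symm_apply] at this
  exact this.symm

section

variable {A H : Type*} [Ring A] [HopfAlgebra L A] [Algebra K A] [IsScalarTower K L A]
  [Ring H] [Algebra K H]

theorem descentMap_mul (f : H →ₐ[K] A) (s t : H ⊗[K] H) :
    descentMap (L := L) f.toLinearMap f.toLinearMap (s * t) =
      descentMap f.toLinearMap f.toLinearMap s * descentMap f.toLinearMap f.toLinearMap t := by
  induction s with
  | zero => simp
  | add x y hx hy => rw [add_mul, map_add, hx, hy, map_add, add_mul]
  | tmul a b =>
    induction t with
    | zero => simp
    | add x y hx hy => rw [mul_add, map_add, hx, hy, map_add, mul_add]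
    | tmul c d => simp

/-- Data that make a `K`-subalgebra `H` of an `L`-Hopf algebra `A` a `K`-Hopf algebra. -/
structure HopfDescentData (f : H →ₐ[K] A) {ι : Type*} (b : Module.Basis ι K H) : Prop where
  linearIndependent : LinearIndependent L fun i => f (b i)
  comul : ∀ h, ∃ t : H ⊗[K] H, descentMap f.toLinearMap f.toLinearMap t =
    Coalgebra.comul (R := L) (f h)
  counit : ∀ h, ∃ c : K, algebraMap K L c = Coalgebra.counit (R := L) (f h)
  antipode : ∀ h, ∃ h', f h' = HopfAlgebra.antipode L (f h)

namespace HopfDescentData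

variable {f : H →ₐ[K] A} {ι : Type*} {b : Module.Basis ι K H} (D : HopfDescentData (L := L) f b)

include D

theorem injective : Function.Injective f :=
  LinearMap.injective_of_linearIndependent_basis b f.toLinearMap
    (D.linearIndependent.restrict_scalars' K)

theorem injective_descentMap :
    Function.Injective (descentMap (L := L) f.toLinearMap f.toLinearMap) :=
  injective_descentMap_of_linearIndependent (b := b) (c := b) D.linearIndependent
    D.linearIndependent

/-- Coassociativity on `H` is an identity in the triple tensor product; injectivity here allows it
to be tested over `L`. -/
theorem injective_descentMap₃ : Function.Injective
    (descentMap (L := L) f.toLinearMap (descentMap (L := L) f.toLinearMap f.toLinearMap)) :=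
  injective_descentMap_of_linearIndependent (b := b) (c := b.tensorProduct b) D.linearIndependent
    (linearIndependent_descentMap (b := b) (c := b) D.linearIndependent D.linearIndependent)

/-- The descended comultiplication. -/
noncomputable def comul' : H →ₗ[K] H ⊗[K] H :=
  LinearMap.liftInjective (descentMap (L := L) f.toLinearMap f.toLinearMap) D.injective_descentMap
    ((Coalgebra.comul (R := L) (A := A)).restrictScalars K ∘ₗ f.toLinearMap) D.comul

theorem descentMap_comul' (h : H) : descentMap (L := L) f.toLinearMap f.toLinearMap (D.comul' h) =
    Coalgebra.comul (R := L) (f h) :=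
  LinearMap.apply_liftInjective ..

/-- The descended counit. -/
noncomputable def counit' : H →ₗ[K] K :=
  LinearMap.liftInjective (Algebra.linearMap K L) (algebraMap K L).injective
    ((Coalgebra.counit (R := L) (A := A)).restrictScalars K ∘ₗ f.toLinearMap) D.counit

theorem algebraMap_counit' (h : H) : algebraMap K L (D.counit' h) =
    Coalgebra.counit (R := L) (f h) :=
  LinearMap.apply_liftInjective (Algebra.linearMap K L) ..

/-- The descended antipode. -/
noncomputable def antipode' : H →ₗ[K] H :=
  LinearMap.liftInjective f.toLinearMap D.injective
    ((HopfAlgebra.antipode L (A := A)).restrictScalars K ∘ₗ f.toLinearMap) D.antipode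

theorem apply_antipode' (h : H) : f (D.antipode' h) = HopfAlgebra.antipode L (f h) :=
  LinearMap.apply_liftInjective f.toLinearMap ..

/-- This and the following compatibilities say that the descended operations become those of `A`
under injective maps, so each Hopf algebra axiom for `H` is inherited from `A`. -/
theorem descentMap_lTensor_comul' (t : H ⊗[K] H) :
    descentMap (L := L) f.toLinearMap (descentMap (L := L) f.toLinearMap f.toLinearMap)
      (D.comul'.lTensor H t) =
      (Coalgebra.comul (R := L)).lTensor A
        (descentMap (L := L) f.toLinearMap f.toLinearMap t) := by
  induction t with
  | zero => simp
  | add x y hx hy => rw [map_add, map_add, hx, hy, map_add, map_add]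
  | tmul x y =>
    rw [LinearMap.lTensor_tmul, descentMap_tmul, descentMap_tmul, LinearMap.lTensor_tmul,
      D.descentMap_comul']
    rfl

omit D in
theorem descentMap_assoc (t : H ⊗[K] H) (y : H) :
    descentMap (L := L) f.toLinearMap (descentMap (L := L) f.toLinearMap f.toLinearMap)
      (TensorProduct.assoc K H H H (t ⊗ₜ y)) =
      TensorProduct.assoc L A A A
        (descentMap (L := L) f.toLinearMap f.toLinearMap t ⊗ₜ f y) := by
  induction t with
  | zero => simp
  | add x y hx hy => rw [TensorProduct.add_tmul, map_add, map_add, hx, hy, map_add,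
      TensorProduct.add_tmul, map_add]
  | tmul a b => simp

theorem descentMap_rTensor_comul' (t : H ⊗[K] H) :
    descentMap (L := L) f.toLinearMap (descentMap (L := L) f.toLinearMap f.toLinearMap)
      (TensorProduct.assoc K H H H (D.comul'.rTensor H t)) =
      TensorProduct.assoc L A A A ((Coalgebra.comul (R := L)).rTensor A
        (descentMap (L := L) f.toLinearMap f.toLinearMap t)) := by
  induction t with
  | zero => simp
  | add x y hx hy => simp only [map_add, hx, hy]
  | tmul x y =>
    rw [LinearMap.rTensor_tmul, descentMap_assoc, descentMap_tmul, LinearMap.rTensor_tmul,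
      D.descentMap_comul']
    rfl

theorem lid_rTensor_counit' (t : H ⊗[K] H) :
    f (TensorProduct.lid K H (D.counit'.rTensor H t)) =
      TensorProduct.lid L A ((Coalgebra.counit (R := L)).rTensor A
        (descentMap (L := L) f.toLinearMap f.toLinearMap t)) := by
  induction t with
  | zero => simp
  | add x y hx hy => simp only [map_add, hx, hy]
  | tmul x y =>
    simp only [LinearMap.rTensor_tmul, TensorProduct.lid_tmul, map_smul, descentMap_tmul,
      AlgHom.toLinearMap_apply]
    rw [← D.algebraMap_counit', algebraMap_smul]

theorem rid_lTensor_counit' (t : H ⊗[K] H) :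
    f (TensorProduct.rid K H (D.counit'.lTensor H t)) =
      TensorProduct.rid L A ((Coalgebra.counit (R := L)).lTensor A
        (descentMap (L := L) f.toLinearMap f.toLinearMap t)) := by
  induction t with
  | zero => simp
  | add x y hx hy => simp only [map_add, hx, hy]
  | tmul x y =>
    simp only [LinearMap.lTensor_tmul, TensorProduct.rid_tmul, map_smul, descentMap_tmul,
      AlgHom.toLinearMap_apply]
    rw [← D.algebraMap_counit', algebraMap_smul]

theorem mul'_antipode'_rTensor (t : H ⊗[K] H) :
    f (LinearMap.mul' K H (D.antipode'.rTensor H t)) =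
      LinearMap.mul' L A ((HopfAlgebra.antipode L).rTensor A
        (descentMap (L := L) f.toLinearMap f.toLinearMap t)) := by
  induction t with
  | zero => simp
  | add x y hx hy => simp only [map_add, hx, hy]
  | tmul x y => simp [D.apply_antipode']

theorem mul'_antipode'_lTensor (t : H ⊗[K] H) :
    f (LinearMap.mul' K H (D.antipode'.lTensor H t)) =
      LinearMap.mul' L A ((HopfAlgebra.antipode L).lTensor A
        (descentMap (L := L) f.toLinearMap f.toLinearMap t)) := by
  induction t with
  | zero => simp
  | add x y hx hy => simp only [map_add, hx, hy]
  | tmul x y => simp [D.apply_antipode']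

/-- The descended coalgebra structure. -/
@[reducible] noncomputable def coalgebra : Coalgebra K H where
  comul := D.comul'
  counit := D.counit'
  coassoc := by
    ext h
    apply D.injective_descentMap₃
    simp only [LinearMap.comp_apply, LinearEquiv.coe_coe]
    rw [D.descentMap_rTensor_comul', D.descentMap_lTensor_comul', D.descentMap_comul',
      Coalgebra.coassoc_apply]
  rTensor_counit_comp_comul := by
    ext h
    apply (TensorProduct.lid K H).injective
    apply D.injective
    simp only [LinearMap.comp_apply]
    rw [D.lid_rTensor_counit', D.descentMap_comul', Coalgebra.rTensor_counit_comul]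
    simp
  lTensor_counit_comp_comul := by
    ext h
    apply (TensorProduct.rid K H).injective
    apply D.injective
    simp only [LinearMap.comp_apply]
    rw [D.rid_lTensor_counit', D.descentMap_comul', Coalgebra.lTensor_counit_comul]
    simp

/-- The descended bialgebra structure. -/
@[reducible] noncomputable def bialgebra : Bialgebra K H :=
  letI := D.coalgebra
  Bialgebra.mk' K H
    (by
      apply (algebraMap K L).injective
      refine (D.algebraMap_counit' 1).trans ?_
      simp)
    (by
      intro x y
      apply (algebraMap K L).injective
      refine (D.algebraMap_counit' _).trans ?_
      rw [map_mul, map_mul (algebraMap K L), Bialgebra.counit_mul]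
      exact (congrArg₂ _ (D.algebraMap_counit' x) (D.algebraMap_counit' y)).symm)
    (by
      apply D.injective_descentMap
      refine (D.descentMap_comul' 1).trans ?_
      rw [map_one, Bialgebra.comul_one, Algebra.TensorProduct.one_def,
        Algebra.TensorProduct.one_def, descentMap_tmul]
      simp)
    (by
      intro x y
      apply D.injective_descentMap
      refine (D.descentMap_comul' _).trans ?_
      rw [descentMap_mul, map_mul, Bialgebra.comul_mul]
      exact (congrArg₂ _ (D.descentMap_comul' x) (D.descentMap_comul' y)).symm)

/-- The descended Hopf algebra structure. -/
@[reducible] noncomputable def hopfAlgebra : HopfAlgebra K H :=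
  { D.bialgebra with
    antipode := D.antipode'
    mul_antipode_rTensor_comul := by
      ext h
      apply D.injective
      refine (D.mul'_antipode'_rTensor _).trans ?_
      refine (congrArg _ (congrArg _ (D.descentMap_comul' h))).trans ?_
      rw [HopfAlgebra.mul_antipode_rTensor_comul_apply, ← D.algebraMap_counit',
        ← IsScalarTower.algebraMap_apply]
      exact (f.commutes _).symm
    mul_antipode_lTensor_comul := by
      ext h
      apply D.injective
      refine (D.mul'_antipode'_lTensor _).trans ?_
      refine (congrArg _ (congrArg _ (D.descentMap_comul' h))).trans ?_
      rw [HopfAlgebra.mul_antipode_lTensor_comul_apply, ← D.algebraMap_counit',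
        ← IsScalarTower.algebraMap_apply]
      exact (f.commutes _).symm }

end HopfDescentData

end

end HopfDescent

/-! ### Twisted group algebras and their fixed rings -/

section Twist

variable {K : Type u} {L : Type v} [Field K] [Field L] [Algebra K L] {N : Type w} [Group N]

/-- The semilinear action of `g ∈ Gal(L/K)` on `L[N]` attached to an action of `Gal(L/K)` on `N`. -/
noncomputable def twist (a : Gal(L/K) →* MulAut N) (g : Gal(L/K)) :
    MonoidAlgebra L N →ₐ[K] MonoidAlgebra L N :=
  (MonoidAlgebra.mapDomainAlgHom K L (a g).toMonoidHom).comp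
    (MonoidAlgebra.mapAlgHom N g.toAlgHom)

variable (a : Gal(L/K) →* MulAut N)

@[simp] theorem twist_single (g : Gal(L/K)) (ν : N) (c : L) :
    twist a g (MonoidAlgebra.single ν c) = MonoidAlgebra.single (a g ν) (g c) := by
  simp [twist]

theorem twist_smul (g : Gal(L/K)) (c : L) (w : MonoidAlgebra L N) :
    twist a g (c • w) = g c • twist a g w := by
  induction w using MonoidAlgebra.induction_linear with
  | zero => simp
  | add x y hx hy => rw [smul_add, map_add, hx, hy, map_add, smul_add]
  | single ν d => simp

theorem twist_twist (g h : Gal(L/K)) (w : MonoidAlgebra L N) :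
    twist a g (twist a h w) = twist a (g * h) w := by
  induction w using MonoidAlgebra.induction_linear with
  | zero => simp
  | add x y hx hy => simp only [map_add, hx, hy]
  | single ν d => simp

theorem twist_one (w : MonoidAlgebra L N) : twist a 1 w = w := by
  induction w using MonoidAlgebra.induction_linear with
  | zero => simp
  | add x y hx hy => rw [map_add, hx, hy]
  | single ν d => simp

/-- The `K`-subalgebra of `L[N]` fixed by the twisted Galois action. -/
noncomputable def twistedFixed : Subalgebra K (MonoidAlgebra L N) :=
  ⨅ g : Gal(L/K), AlgHom.equalizer (twist a g) (AlgHom.id K _)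

theorem mem_twistedFixed {w : MonoidAlgebra L N} :
    w ∈ twistedFixed a ↔ ∀ g : Gal(L/K), twist a g w = w := by
  simp [twistedFixed, Algebra.mem_iInf, AlgHom.mem_equalizer]

variable [FiniteDimensional K L]

/-- The trace `L[N] → L[N]^G`. -/
noncomputable def twistTrace (w : MonoidAlgebra L N) : twistedFixed a :=
  ⟨∑ g : Gal(L/K), twist a g w, (mem_twistedFixed a).mpr fun h => by
    rw [map_sum]
    refine Fintype.sum_equiv (Equiv.mulLeft h) _ _ fun g => ?_
    rw [twist_twist]
    rfl⟩

theorem coe_twistTrace (w : MonoidAlgebra L N) :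
    (twistTrace a w : MonoidAlgebra L N) = ∑ g : Gal(L/K), twist a g w := rfl

theorem twistTrace_smul_of_mem (c : L) {h : MonoidAlgebra L N} (hh : h ∈ twistedFixed a) :
    (twistTrace a (c • h) : MonoidAlgebra L N) = (∑ g : Gal(L/K), g c) • h := by
  rw [coe_twistTrace, Finset.sum_smul]
  exact Finset.sum_congr rfl fun g _ => by rw [twist_smul, (mem_twistedFixed a).mp hh g]

theorem twistTrace_add (w w' : MonoidAlgebra L N) :
    twistTrace a (w + w') = twistTrace a w + twistTrace a w' := by
  ext : 1
  simp [coe_twistTrace, Finset.sum_add_distrib]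

-- Expanding the traces and summing over `i` first, the dual system kills every term except that of
-- the identity, so `w = ∑ x i • Tr(y i • w)`; applying `g` moves only the coefficients.
open scoped Classical in
theorem twist_eq_sum_twistTrace {m : ℕ} {x y : Fin m → L}
    (hxy : ∀ g : Gal(L/K), ∑ i, x i * g (y i) = if g = 1 then 1 else 0)
    (g : Gal(L/K)) (w : MonoidAlgebra L N) :
    twist a g w = ∑ i, g (x i) • (twistTrace a (y i • w) : MonoidAlgebra L N) := by
  have key : ∑ i, x i • (twistTrace a (y i • w) : MonoidAlgebra L N) = w := by
    simp only [coe_twistTrace, twist_smul, Finset.smul_sum, smul_smul]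
    rw [Finset.sum_comm]
    simp only [← Finset.sum_smul, hxy]
    rw [Finset.sum_eq_single 1]
    · rw [if_pos rfl, one_smul, twist_one]
    · intro b _ hb
      rw [if_neg hb, zero_smul]
    · simp
  nth_rw 1 [← key]
  rw [map_sum]
  refine Finset.sum_congr rfl fun i _ => ?_
  rw [twist_smul, (mem_twistedFixed a).mp (twistTrace a (y i • w)).2 g]

/-- The natural map `L ⊗ L[N]^G → L[N]`. -/
noncomputable def twistedFixedLift : L ⊗[K] twistedFixed a →ₐ[L] MonoidAlgebra L N :=
  Algebra.TensorProduct.lift (Algebra.ofId L _) (twistedFixed a).val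
    (fun c h => show Commute _ _ from Algebra.commutes c h.1)

@[simp] theorem twistedFixedLift_tmul (c : L) (h : twistedFixed a) :
    twistedFixedLift a (c ⊗ₜ h) = c • (h : MonoidAlgebra L N) := by
  rw [twistedFixedLift, Algebra.TensorProduct.lift_tmul, Algebra.smul_def]
  rfl

theorem bijective_twistedFixedLift [IsGalois K L] : Function.Bijective (twistedFixedLift a) := by
  classical
  obtain ⟨m, x, y, hxy⟩ := exists_galois_dual K L
  have hxy' : ∀ c : L, ∑ i, x i * ∑ g : Gal(L/K), g (y i * c) = c := by
    intro c
    simp only [map_mul, Finset.mul_sum, ← mul_assoc]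
    rw [Finset.sum_comm]
    simp only [← Finset.sum_mul, hxy]
    rw [Finset.sum_eq_single 1]
    · simp
    · intro b _ hb
      rw [if_neg hb, zero_mul]
    · simp
  -- The inverse map is the expansion of `w` in traces with respect to the dual system.
  let Ω : MonoidAlgebra L N → L ⊗[K] twistedFixed a :=
    fun w => ∑ i, x i ⊗ₜ twistTrace a (y i • w)
  have hΩadd : ∀ w w', Ω (w + w') = Ω w + Ω w' := by
    intro w w'
    simp only [Ω, smul_add, twistTrace_add, TensorProduct.tmul_add, Finset.sum_add_distrib]
  refine Function.bijective_iff_has_inverse.mpr ⟨Ω, fun t => ?_, fun w => ?_⟩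
  · induction t with
    | zero =>
      rw [map_zero]
      simpa using hΩadd 0 0
    | add s t hs ht => rw [map_add, hΩadd, hs, ht]
    | tmul c h =>
      rw [twistedFixedLift_tmul]
      choose d hd using fun i => exists_sum_galois_eq (K := K) (y i * c)
      have h1 : ∀ i, twistTrace a (y i • c • (h : MonoidAlgebra L N)) = d i • h := by
        intro i
        ext : 1
        rw [smul_smul, twistTrace_smul_of_mem a _ h.2, ← hd, algebraMap_smul]
        rfl
      simp only [Ω, h1, TensorProduct.tmul_smul, TensorProduct.smul_tmul', ← TensorProduct.sum_tmul]
      congr 1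
      rw [← hxy' c]
      refine Finset.sum_congr rfl fun i _ => ?_
      rw [← hd, Algebra.smul_def, mul_comm]
  · simp only [Ω, map_sum, twistedFixedLift_tmul]
    exact (twist_eq_sum_twistTrace a hxy 1 w).symm.trans (twist_one a w)

theorem twistedFixedLift_map (g : Gal(L/K)) (t : L ⊗[K] twistedFixed a) :
    twistedFixedLift a (Algebra.TensorProduct.map g.toAlgHom (AlgHom.id K _) t) =
      twist a g (twistedFixedLift a t) := by
  induction t with
  | zero => simp
  | add s t hs ht => simp only [map_add, hs, ht]
  | tmul c h => simp [twist_smul, (mem_twistedFixed a).mp h.2 g]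

theorem linearIndependent_twistedFixed [IsGalois K L] {ι : Type*}
    (b : Module.Basis ι K (twistedFixed a)) :
    LinearIndependent L fun i => (twistedFixed a).val (b i) := by
  have h := (b.baseChange L).linearIndependent.map' (twistedFixedLift a).toLinearMap
    (LinearMap.ker_eq_bot.mpr (bijective_twistedFixedLift a).1)
  have e : (fun i => (twistedFixed a).val (b i)) =
      (twistedFixedLift a).toLinearMap ∘ b.baseChange L := by
    funext i
    simp [Module.Basis.baseChange_apply]
  rw [e]
  exact h

theorem comul_single_smul (ν : N) (c : L) :
    Coalgebra.comul (R := L) (MonoidAlgebra.single ν c) =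
      c • (MonoidAlgebra.single ν (1 : L) ⊗ₜ[L] MonoidAlgebra.single ν (1 : L)) := by
  rw [MonoidAlgebra.comul_single, CommSemiring.comul_apply, TensorProduct.map_tmul,
    ← TensorProduct.tmul_smul]
  simp

/-- The coproduct of the trace of `c ν` is `∑ g(c) gν ⊗ gν`. Writing each `gν` through the fixed
elements `t i`, the coefficient of `t i ⊗ t j` becomes the trace of `c x_i x_j`, which lies in `K`.
-/
theorem exists_descentMap_eq_comul [CharZero K] [IsGalois K L] (h : twistedFixed a) :
    ∃ t : twistedFixed a ⊗[K] twistedFixed a,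
      descentMap (twistedFixed a).val.toLinearMap (twistedFixed a).val.toLinearMap t =
        Coalgebra.comul (R := L) (h : MonoidAlgebra L N) := by
  classical
  obtain ⟨m, x, y, hxy⟩ := exists_galois_dual K L
  obtain ⟨z, hz⟩ := exists_sum_galois_eq_one (K := K) (L := L)
  have key : ∀ w : MonoidAlgebra L N, ∃ t : twistedFixed a ⊗[K] twistedFixed a,
      descentMap (twistedFixed a).val.toLinearMap (twistedFixed a).val.toLinearMap t =
        Coalgebra.comul (R := L) (twistTrace a w : MonoidAlgebra L N) := by
    intro w
    induction w using MonoidAlgebra.induction_linear with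
    | zero => exact ⟨0, by simp [coe_twistTrace]⟩
    | add v w hv hw =>
      obtain ⟨s, hs⟩ := hv
      obtain ⟨t, ht⟩ := hw
      exact ⟨s + t, by rw [map_add, hs, ht, twistTrace_add, Subalgebra.coe_add, map_add]⟩
    | single ν c =>
      choose d hd using fun i j => exists_sum_galois_eq (K := K) (c * (x i * x j))
      let t := fun i => twistTrace a (y i • MonoidAlgebra.single ν (1 : L))
      refine ⟨∑ i, ∑ j, d i j • (t i ⊗ₜ t j), ?_⟩
      have h1 : ∀ g : Gal(L/K), MonoidAlgebra.single (a g ν) (1 : L) =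
          ∑ i, g (x i) • (t i : MonoidAlgebra L N) := by
        intro g
        rw [← twist_eq_sum_twistTrace a hxy]
        simp
      have h2 : Coalgebra.comul (R := L) (twistTrace a (MonoidAlgebra.single ν c) :
          MonoidAlgebra L N) = ∑ g : Gal(L/K), ∑ i, ∑ j, g (c * (x i * x j)) •
            ((t i : MonoidAlgebra L N) ⊗ₜ[L] (t j : MonoidAlgebra L N)) := by
        rw [coe_twistTrace, map_sum]
        refine Finset.sum_congr rfl fun g _ => ?_
        rw [twist_single, comul_single_smul, h1, TensorProduct.sum_tmul, Finset.smul_sum]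
        refine Finset.sum_congr rfl fun i _ => ?_
        rw [TensorProduct.tmul_sum, Finset.smul_sum]
        refine Finset.sum_congr rfl fun j _ => ?_
        rw [TensorProduct.tmul_smul, ← TensorProduct.smul_tmul', smul_smul, smul_smul, map_mul,
          map_mul]
        congr 1
        ring
      rw [h2]
      simp only [map_sum]
      refine Eq.trans ?_ Finset.sum_comm
      refine Finset.sum_congr rfl fun i _ => ?_
      refine Eq.trans ?_ Finset.sum_comm
      refine Finset.sum_congr rfl fun j _ => ?_
      rw [map_smul, descentMap_tmul, ← Finset.sum_smul, ← hd, algebraMap_smul]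
      rfl
  -- Since `z` has trace 1, the fixed element `h` is itself the trace of `z • h`.
  obtain ⟨t, ht⟩ := key (z • (h : MonoidAlgebra L N))
  refine ⟨t, ?_⟩
  rw [ht, twistTrace_smul_of_mem a z h.2, hz, one_smul]

theorem counit_twist (g : Gal(L/K)) (w : MonoidAlgebra L N) :
    Coalgebra.counit (R := L) (twist a g w) = g (Coalgebra.counit (R := L) w) := by
  induction w using MonoidAlgebra.induction_linear with
  | zero => simp
  | add x y hx hy => simp only [map_add, hx, hy]
  | single ν d => simp

theorem antipode_twist (g : Gal(L/K)) (w : MonoidAlgebra L N) :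
    HopfAlgebra.antipode L (twist a g w) = twist a g (HopfAlgebra.antipode L w) := by
  induction w using MonoidAlgebra.induction_linear with
  | zero => simp
  | add x y hx hy => simp only [map_add, hx, hy]
  | single ν d => simp

theorem hopfDescentData_twistedFixed [CharZero K] [IsGalois K L] :
    HopfDescentData (L := L) (twistedFixed a).val (Module.Basis.ofVectorSpace K (twistedFixed a)) where
  linearIndependent := linearIndependent_twistedFixed a _
  comul h := exists_descentMap_eq_comul a h
  counit h := algebraMap_of_forall_galois_fixed fun g => by
    rw [← counit_twist a, Subalgebra.coe_val, (mem_twistedFixed a).mp h.2 g]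
  antipode h := ⟨⟨HopfAlgebra.antipode L (h : MonoidAlgebra L N),
    (mem_twistedFixed a).mpr fun g => by
      rw [← antipode_twist, (mem_twistedFixed a).mp h.2 g]⟩, rfl⟩

end Twist

/-! ### Hopf-Galois structures from twisted group algebras -/

section PairEval

variable {K : Type u} {L : Type v} [Field K] [Field L] [Algebra K L]

/-- The functional `w ⊗ w' ↦ φ(w)(x) φ(w')(y)`. -/
noncomputable def pairEval {A : Type*} [AddCommGroup A] [Module L A] (φ : A →ₗ[L] Module.End K L)
    (x y : L) : A ⊗[L] A →ₗ[L] L :=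
  TensorProduct.lift (LinearMap.mk₂ L (fun w w' => φ w x * φ w' y)
    (fun _ _ _ => by rw [map_add, LinearMap.add_apply, add_mul])
    (fun c x y => by rw [map_smul, LinearMap.smul_apply, smul_mul_assoc])
    (fun _ _ _ => by rw [map_add, LinearMap.add_apply, mul_add])
    (fun c x y => by rw [map_smul, LinearMap.smul_apply, mul_smul_comm]))

@[simp] theorem pairEval_tmul {A : Type*} [AddCommGroup A] [Module L A]
    (φ : A →ₗ[L] Module.End K L) (x y : L) (w w' : A) :
    pairEval φ x y (w ⊗ₜ w') = φ w x * φ w' y := rfl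

end PairEval

/-- The compatibility of a bijection `e : G → N` with an action `a` of `G` on `N` that makes
`N` the additive group of a skew brace with multiplicative group `G`. -/
def IsBraceDatum {G : Type*} [Group G] {N : Type*} [Group N] (e : G ≃ N) (a : G →* MulAut N) : Prop :=
  ∀ τ g : G, e (τ * g) = e τ * a τ (e g)

theorem IsBraceDatum.apply_one {G N : Type*} [Group G] [Group N] {e : G ≃ N} {a : G →* MulAut N}
    (h : IsBraceDatum e a) : e 1 = 1 := by
  have := h 1 1
  rw [mul_one, MonoidHom.map_one, MulAut.one_apply] at this
  exact (mul_eq_left.mp this.symm)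

section Brace

variable {K : Type u} {L : Type v} [Field K] [Field L] [Algebra K L] [FiniteDimensional K L]
  [IsGalois K L] {N : Type w} [Group N]

/-- The `L`-linear bijection `L[N] → End_K(L)` sending `e g` to `g`. -/
noncomputable def braceEnd (e : Gal(L/K) ≃ N) : MonoidAlgebra L N ≃ₗ[L] Module.End K L :=
  (MonoidAlgebra.coeffLinearEquiv L).trans ((galoisBasis K L).reindex e).repr.symm

theorem braceEnd_single (e : Gal(L/K) ≃ N) (ν : N) (c : L) :
    braceEnd e (MonoidAlgebra.single ν c) = c • ((e.symm ν).toLinearMap : Module.End K L) := by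
  simp [braceEnd]

variable {e : Gal(L/K) ≃ N} {a : Gal(L/K) →* MulAut N} (h : IsBraceDatum e a)

include h

/-- The brace relation says precisely that twisting by `τ` and then multiplying by `e τ` corresponds
to composing with `τ`. On fixed elements the twist disappears, which makes `braceEnd` multiplicative
there. -/
theorem IsBraceDatum.braceEnd_single_mul_twist (τ : Gal(L/K)) (c : L) (w : MonoidAlgebra L N)
    (y : L) : braceEnd e (MonoidAlgebra.single (e τ) c * twist a τ w) y =
      c * τ (braceEnd e w y) := by
  induction w using MonoidAlgebra.induction_linear with
  | zero => simp
  | add v w hv hw =>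
    rw [map_add, mul_add, map_add, LinearMap.add_apply, hv, hw, map_add, LinearMap.add_apply,
      map_add, mul_add]
  | single ν d =>
    obtain ⟨g, rfl⟩ := e.surjective ν
    rw [twist_single, MonoidAlgebra.single_mul_single, ← h, braceEnd_single, braceEnd_single]
    simp [mul_assoc]

theorem IsBraceDatum.braceEnd_mul (w : MonoidAlgebra L N) {k : MonoidAlgebra L N}
    (hk : k ∈ twistedFixed a) : braceEnd e (w * k) = braceEnd e w * braceEnd e k := by
  ext y
  induction w using MonoidAlgebra.induction_linear with
  | zero => simp
  | add v w hv hw => simp only [add_mul, map_add, LinearMap.add_apply, hv, hw]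
  | single ν c =>
    obtain ⟨τ, rfl⟩ := e.surjective ν
    rw [← (mem_twistedFixed a).mp hk τ, h.braceEnd_single_mul_twist,
      (mem_twistedFixed a).mp hk τ, braceEnd_single]
    simp

/-- The action of `L[N]^G` on `L`. -/
noncomputable def IsBraceDatum.act : twistedFixed a →ₐ[K] Module.End K L :=
  AlgHom.ofLinearMap (((braceEnd e).toLinearMap.restrictScalars K) ∘ₗ
    (twistedFixed a).val.toLinearMap)
    (by
      ext y
      simp [MonoidAlgebra.one_def, braceEnd_single, ← h.apply_one])
    (fun w k => h.braceEnd_mul w.1 k.2)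

theorem IsBraceDatum.act_apply (w : twistedFixed a) :
    h.act w = braceEnd e (w : MonoidAlgebra L N) := rfl

theorem IsBraceDatum.lift_act (t : L ⊗[K] twistedFixed a) :
    TensorProduct.lift
      ((LinearMap.mul K (Module.End K L)).compl₁₂ (Algebra.lmul K L).toLinearMap
        h.act.toLinearMap) t = braceEnd e (twistedFixedLift a t) := by
  induction t with
  | zero => simp
  | add s t hs ht => simp only [map_add, hs, ht]
  | tmul c w =>
    ext y
    simp [h.act_apply]

omit h in
theorem pairEval_comul_single (w : MonoidAlgebra L N) (x y : L) :
    pairEval (braceEnd e).toLinearMap x y (Coalgebra.comul (R := L) w) =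
      braceEnd e w (x * y) := by
  induction w using MonoidAlgebra.induction_linear with
  | zero => simp
  | add v w hv hw => simp only [map_add, LinearMap.add_apply, hv, hw]
  | single ν c => 
    rw [comul_single_smul, map_smul, pairEval_tmul]
    simp [braceEnd_single]

end Brace

section

variable {K : Type u} {L : Type v} [Field K] [Field L] [Algebra K L] [FiniteDimensional K L]
  [IsGalois K L] [CharZero K] {N : Type v} [Group N]
  {e : Gal(L/K) ≃ N} {a : Gal(L/K) →* MulAut N} (h : IsBraceDatum e a)

/-- The Hopf-Galois structure attached to a skew brace structure on the Galois group. -/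
noncomputable def IsBraceDatum.hopfGaloisStructure : HopfGaloisStructure K L :=
  letI := (hopfDescentData_twistedFixed (K := K) (L := L) a).hopfAlgebra
  { H := twistedFixed a
    act := h.act
    act_one := fun w => by
      refine Eq.trans ?_ ((hopfDescentData_twistedFixed a).algebraMap_counit' w).symm
      change braceEnd e (w : MonoidAlgebra L N) 1 = Coalgebra.counit (R := L) (w : MonoidAlgebra L N)
      induction (w : MonoidAlgebra L N) using MonoidAlgebra.induction_linear with
      | zero => simp
      | add v w hv hw => simp only [map_add, LinearMap.add_apply, hv, hw]
      | single ν c => simp [braceEnd_single]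
    act_mul := fun w x y => by
      have key : ∀ t : twistedFixed a ⊗[K] twistedFixed a,
          LinearMap.mul' K L (TensorProduct.map (h.act.toLinearMap.flip x)
            (h.act.toLinearMap.flip y) t) = pairEval (braceEnd e).toLinearMap x y
              (descentMap (twistedFixed a).val.toLinearMap (twistedFixed a).val.toLinearMap t) := by
        intro t
        induction t with
        | zero => simp
        | add s t hs ht => simp only [map_add, hs, ht]
        | tmul w k => simp [h.act_apply]
      refine Eq.trans ?_ (key _).symm
      refine Eq.trans ?_ (congrArg _ ((hopfDescentData_twistedFixed a).descentMap_comul' w)).symm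
      exact (pairEval_comul_single _ x y).symm
    bijective := by
      have : (TensorProduct.lift
          ((LinearMap.mul K (Module.End K L)).compl₁₂ (Algebra.lmul K L).toLinearMap
            h.act.toLinearMap) : L ⊗[K] twistedFixed a → Module.End K L) =
          braceEnd e ∘ twistedFixedLift a := funext h.lift_act
      rw [this]
      exact (braceEnd e).bijective.comp (bijective_twistedFixedLift a) }

end

/-! ### The skew brace of a Hopf-Galois structure -/

section PairEval

variable {K : Type u} {L : Type v} [Field K] [Field L] [Algebra K L] [FiniteDimensional K L]
  [IsGalois K L]

/-- Dedekind independence, applied once in `x` and once in `y`, kills all coefficients of `t` in the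
basis indexed by pairs of automorphisms. Identities between coproducts can therefore be tested by
evaluation. -/
theorem eq_zero_of_forall_pairEval {A : Type*} [AddCommGroup A] [Module L A]
    (φ : A ≃ₗ[L] Module.End K L) {t : A ⊗[L] A}
    (ht : ∀ x y, pairEval φ.toLinearMap x y t = 0) : t = 0 := by
  let b := (galoisBasis K L).map φ.symm
  have hb : ∀ g x, φ (b g) x = g x := fun g x => by simp [b]
  have hsep : ∀ c : Gal(L/K) → L, (∀ x, ∑ g, c g * g x = 0) → c = 0 := by
    intro c hc
    funext g
    refine Fintype.linearIndependent_iff.mp (AlgEquiv.linearIndependent_toLinearMap K L) c ?_ g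
    ext x
    simpa using hc x
  have hsum := (b.tensorProduct b).sum_repr t
  set c := fun g h => (b.tensorProduct b).repr t (g, h) with hc
  have key : ∀ x y, ∑ g : Gal(L/K), (∑ h : Gal(L/K), c g h * h y) * g x = 0 := by
    intro x y
    rw [← ht x y]
    conv_rhs => rw [← hsum]
    rw [Fintype.sum_prod_type, map_sum]
    refine Finset.sum_congr rfl fun g _ => ?_
    rw [map_sum, Finset.sum_mul]
    refine Finset.sum_congr rfl fun h _ => ?_
    rw [Module.Basis.tensorProduct_apply, map_smul, pairEval_tmul]
    simp only [LinearEquiv.coe_coe, hb, hc, smul_eq_mul]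
    ring
  have hz : ∀ g h, c g h = 0 := fun g h => by
    refine congrFun (hsep (c g) fun y => ?_) h
    exact congrFun (hsep (fun g => ∑ h : Gal(L/K), c g h * h y) fun x => key x y) g
  rw [← hsum]
  exact Finset.sum_eq_zero fun i _ => by
    rw [show (b.tensorProduct b).repr t i = 0 from hz i.1 i.2, zero_smul]

end PairEval

namespace HopfGaloisStructure

variable {K : Type u} {L : Type v} [Field K] [Field L] [Algebra K L]
  (S : HopfGaloisStructure K L)

/-- The isomorphism `L ⊗ H ≃ End_K(L)`. -/
noncomputable def endEquiv : L ⊗[K] S.H ≃ₗ[L] Module.End K L :=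
  LinearEquiv.ofBijective
    { TensorProduct.lift
      ((LinearMap.mul K (Module.End K L)).compl₁₂ (Algebra.lmul K L).toLinearMap
        S.act.toLinearMap) with
      map_smul' := fun c t => by
        induction t with
        | zero => simp
        | add s t hs ht =>
          simp only [AddHom.toFun_eq_coe, LinearMap.coe_toAddHom] at hs ht ⊢
          rw [smul_add, map_add, hs, ht, map_add, smul_add]
        | tmul d h =>
          ext y
          simp [TensorProduct.smul_tmul', mul_assoc] }
    S.bijective

@[simp] theorem endEquiv_tmul (c : L) (h : S.H) :
    S.endEquiv (c ⊗ₜ h) = c • S.act h := by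
  ext y
  simp [endEquiv]

theorem injective_act : Function.Injective S.act := by
  intro h k hhk
  have : (1 : L) ⊗ₜ[K] h = (1 : L) ⊗ₜ[K] k := S.endEquiv.injective (by simp [hhk])
  exact Algebra.TensorProduct.includeRight_injective (algebraMap K L).injective this

/-- The inclusion `H ⊗_K H → (L ⊗ H) ⊗_L (L ⊗ H)`. -/
noncomputable def inclTensor : S.H ⊗[K] S.H →ₗ[K] (L ⊗[K] S.H) ⊗[L] (L ⊗[K] S.H) :=
  descentMap (Algebra.TensorProduct.includeRight : S.H →ₐ[K] L ⊗[K] S.H).toLinearMap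
    (Algebra.TensorProduct.includeRight : S.H →ₐ[K] L ⊗[K] S.H).toLinearMap

theorem injective_inclTensor : Function.Injective S.inclTensor := by
  let b := Module.Basis.ofVectorSpace K S.H
  have hb : LinearIndependent L fun i =>
      (Algebra.TensorProduct.includeRight : S.H →ₐ[K] L ⊗[K] S.H).toLinearMap (b i) := by
    have e : (fun i => (Algebra.TensorProduct.includeRight : S.H →ₐ[K] L ⊗[K] S.H).toLinearMap
        (b i)) = b.baseChange L := by
      funext i
      simp [Module.Basis.baseChange_apply]
    rw [e]
    exact (b.baseChange L).linearIndependent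
  exact injective_descentMap_of_linearIndependent hb hb

theorem pairEval_inclTensor (x y : L) (t : S.H ⊗[K] S.H) :
    pairEval S.endEquiv.toLinearMap x y (S.inclTensor t) =
      LinearMap.mul' K L (TensorProduct.map (S.act.toLinearMap.flip x)
        (S.act.toLinearMap.flip y) t) := by
  induction t with
  | zero => simp
  | add s t hs ht => simp only [map_add, hs, ht]
  | tmul h k => simp [inclTensor]

theorem comul_tmul_eq (c : L) (h : S.H) :
    Coalgebra.comul (R := L) (c ⊗ₜ[K] h) =
      c • S.inclTensor (Coalgebra.comul (R := K) h) := by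
  rw [TensorProduct.comul_tmul, CommSemiring.comul_apply]
  induction (Coalgebra.comul (R := K) h) with
  | zero => simp
  | add s t hs ht => rw [TensorProduct.tmul_add, map_add, hs, ht, map_add, smul_add]
  | tmul k l =>
    have e : c ⊗ₜ[K] l = c • ((1 : L) ⊗ₜ[K] l) := by simp [TensorProduct.smul_tmul']
    rw [TensorProduct.AlgebraTensorModule.tensorTensorTensorComm_tmul, e, TensorProduct.tmul_smul]
    rfl

theorem pairEval_comul (x y : L) (w : L ⊗[K] S.H) :
    pairEval S.endEquiv.toLinearMap x y (Coalgebra.comul (R := L) w) =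
      S.endEquiv w (x * y) := by
  induction w with
  | zero => simp
  | add s t hs ht => simp only [map_add, LinearMap.add_apply, hs, ht]
  | tmul c h =>
    rw [comul_tmul_eq, map_smul, pairEval_inclTensor, ← S.act_mul]
    simp

theorem counit_eq (w : L ⊗[K] S.H) :
    Coalgebra.counit (R := L) w = S.endEquiv w 1 := by
  induction w with
  | zero => simp
  | add s t hs ht => simp only [map_add, LinearMap.add_apply, hs, ht]
  | tmul c h =>
    rw [TensorProduct.counit_tmul]
    simp [S.act_one, Algebra.smul_def, mul_comm]

/-- The semilinear action of the Galois group on `L ⊗ H`. -/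
noncomputable def galAct (τ : Gal(L/K)) : L ⊗[K] S.H →ₐ[K] L ⊗[K] S.H :=
  Algebra.TensorProduct.map τ.toAlgHom (AlgHom.id K S.H)

@[simp] theorem galAct_tmul (τ : Gal(L/K)) (c : L) (h : S.H) :
    S.galAct τ (c ⊗ₜ h) = τ c ⊗ₜ h := by
  simp [galAct]

theorem galAct_smul (τ : Gal(L/K)) (c : L) (w : L ⊗[K] S.H) :
    S.galAct τ (c • w) = τ c • S.galAct τ w := by
  induction w with
  | zero => simp
  | add s t hs ht => rw [smul_add, map_add, hs, ht, map_add, smul_add]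
  | tmul d h => simp [TensorProduct.smul_tmul']

theorem galAct_mul (τ g : Gal(L/K)) (w : L ⊗[K] S.H) :
    S.galAct (τ * g) w = S.galAct τ (S.galAct g w) := by
  induction w with
  | zero => simp
  | add s t hs ht => simp only [map_add, hs, ht]
  | tmul d h => simp

theorem galAct_one (w : L ⊗[K] S.H) : S.galAct 1 w = w := by
  induction w with
  | zero => simp
  | add s t hs ht => simp only [map_add, hs, ht]
  | tmul d h => simp

/-- The element of `L ⊗ H` that acts on `L` as the automorphism `g`. -/
noncomputable def autElem (g : Gal(L/K)) : L ⊗[K] S.H :=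
  S.endEquiv.symm g.toLinearMap

@[simp] theorem endEquiv_autElem (g : Gal(L/K)) : S.endEquiv (S.autElem g) = g.toLinearMap := by
  simp [autElem]

/-- Scalars are central in `L ⊗ H` but not in `End_K(L)`, so `endEquiv` is not multiplicative.
Applying `τ` to the coefficients of `w` supplies the correction; for `w` the element of `g`, this is
the brace relation. -/
theorem endEquiv_mul_galAct (τ : Gal(L/K)) (w : L ⊗[K] S.H) (y : L) :
    S.endEquiv (S.autElem τ * S.galAct τ w) y = τ (S.endEquiv w y) := by
  have key : ∀ (v : L ⊗[K] S.H) (c : L) (h : S.H),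
      S.endEquiv (v * (c ⊗ₜ h)) y = c * S.endEquiv v (S.act h y) := by
    intro v c h
    induction v with
    | zero => simp
    | add s t hs ht => simp only [add_mul, map_add, LinearMap.add_apply, hs, ht, mul_add]
    | tmul d k =>
      rw [Algebra.TensorProduct.tmul_mul_tmul]
      simp [mul_assoc, mul_left_comm]
  induction w with
  | zero => simp
  | add s t hs ht => simp only [map_add, mul_add, LinearMap.add_apply, hs, ht]
  | tmul c h => simp [key]

theorem autElem_mul (τ g : Gal(L/K)) :
    S.autElem (τ * g) = S.autElem τ * S.galAct τ (S.autElem g) := by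
  apply S.endEquiv.injective
  ext y
  rw [endEquiv_mul_galAct]
  simp

section Fixed

variable [FiniteDimensional K L] [IsGalois K L]

theorem exists_eq_one_tmul [CharZero K] {w : L ⊗[K] S.H} (hw : ∀ τ, S.galAct τ w = w) :
    ∃ h : S.H, w = 1 ⊗ₜ h := by
  obtain ⟨z, hz⟩ := exists_sum_galois_eq_one (K := K) (L := L)
  have key : ∀ v : L ⊗[K] S.H, ∃ h : S.H, ∑ τ, S.galAct τ v = 1 ⊗ₜ h := by
    intro v
    induction v with
    | zero => exact ⟨0, by simp⟩
    | add s t hs ht =>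
      obtain ⟨h, hh⟩ := hs
      obtain ⟨k, hk⟩ := ht
      exact ⟨h + k, by simp only [map_add, Finset.sum_add_distrib, hh, hk,
        TensorProduct.tmul_add]⟩
    | tmul c h =>
      obtain ⟨d, hd⟩ := exists_sum_galois_eq (K := K) c
      refine ⟨d • h, ?_⟩
      simp only [galAct_tmul, ← TensorProduct.sum_tmul]
      rw [← hd, Algebra.algebraMap_eq_smul_one, TensorProduct.smul_tmul]
  obtain ⟨h, hh⟩ := key (z • w)
  refine ⟨h, ?_⟩
  rw [← hh]
  simp only [galAct_smul, hw, ← Finset.sum_smul, hz, one_smul]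

theorem eq_of_forall_act {t t' : S.H ⊗[K] S.H}
    (h : ∀ x y, LinearMap.mul' K L (TensorProduct.map (S.act.toLinearMap.flip x)
        (S.act.toLinearMap.flip y) t) = LinearMap.mul' K L
        (TensorProduct.map (S.act.toLinearMap.flip x) (S.act.toLinearMap.flip y) t')) :
    t = t' := by
  apply S.injective_inclTensor
  rw [← sub_eq_zero]
  refine eq_zero_of_forall_pairEval S.endEquiv fun x y => ?_
  rw [map_sub, pairEval_inclTensor, pairEval_inclTensor, h, sub_self]

theorem isGroupLikeElem_autElem (g : Gal(L/K)) : IsGroupLikeElem L (S.autElem g) where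
  counit_eq_one := by simp [counit_eq]
  comul_eq_tmul_self := by
    rw [← sub_eq_zero]
    refine eq_zero_of_forall_pairEval S.endEquiv fun x y => ?_
    rw [map_sub, pairEval_comul, pairEval_tmul]
    simp

/-- The counit is evaluation at 1 and the coproduct governs the action on products, so a group-like
element acts as a `K`-algebra endomorphism of `L`, which is bijective as `L/K` is algebraic. -/
theorem exists_autElem_eq {w : L ⊗[K] S.H} (hw : IsGroupLikeElem L w) :
    ∃ g, S.autElem g = w := by
  have h1 : S.endEquiv w 1 = 1 := by rw [← counit_eq, hw.counit_eq_one]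
  have h2 : ∀ x y, S.endEquiv w (x * y) = S.endEquiv w x * S.endEquiv w y := fun x y => by
    rw [← pairEval_comul, hw.comul_eq_tmul_self, pairEval_tmul]
    rfl
  let f : L →ₐ[K] L := AlgHom.ofLinearMap (S.endEquiv w) h1 h2
  refine ⟨AlgEquiv.ofBijective f (Algebra.IsAlgebraic.algHom_bijective f), ?_⟩
  apply S.endEquiv.injective
  rw [endEquiv_autElem]
  rfl

/-- The bijection from the Galois group to the group-like elements of `L ⊗ H`. -/
noncomputable def autEquiv : Gal(L/K) ≃ GroupLike L (L ⊗[K] S.H) :=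
  Equiv.ofBijective (fun g => ⟨S.autElem g, S.isGroupLikeElem_autElem g⟩)
    ⟨fun g g' h => by
      have h' : S.autElem g = S.autElem g' := congrArg GroupLike.val h
      have := congrArg S.endEquiv h'
      rw [endEquiv_autElem, endEquiv_autElem] at this
      exact AlgEquiv.toLinearMap_injective this,
    fun w => by
      obtain ⟨g, hg⟩ := S.exists_autElem_eq w.2
      exact ⟨g, GroupLike.ext hg⟩⟩

@[simp] theorem val_autEquiv (g : Gal(L/K)) : (S.autEquiv g).val = S.autElem g := rfl

theorem isGroupLikeElem_galAct (τ : Gal(L/K)) {w : L ⊗[K] S.H} (hw : IsGroupLikeElem L w) :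
    IsGroupLikeElem L (S.galAct τ w) := by
  obtain ⟨g, rfl⟩ := S.exists_autElem_eq hw
  -- The relation `e(τg) = e(τ) · τ(e(g))` exhibits `τ(e(g))` as a quotient of two group-like
  -- elements.
  have h : S.galAct τ (S.autElem g) =
      ((S.autEquiv τ)⁻¹ * S.autEquiv (τ * g)).val := by
    have e := congrArg GroupLike.val (inv_mul_cancel (S.autEquiv τ))
    rw [GroupLike.val_mul, val_autEquiv, GroupLike.val_one] at e
    rw [GroupLike.val_mul, val_autEquiv, autElem_mul, ← mul_assoc, e, one_mul]
  rw [h]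
  exact GroupLike.isGroupLikeElem_val _

/-- The action of the Galois group on the group-like elements of `L ⊗ H`. -/
noncomputable def groupLikeAct : Gal(L/K) →* MulAut (GroupLike L (L ⊗[K] S.H)) where
  toFun τ :=
    { toFun := fun w => ⟨S.galAct τ w.val, S.isGroupLikeElem_galAct τ w.2⟩
      invFun := fun w => ⟨S.galAct τ⁻¹ w.val, S.isGroupLikeElem_galAct τ⁻¹ w.2⟩
      left_inv := fun w => by
        ext
        simp [← galAct_mul, galAct_one]
      right_inv := fun w => by
        ext
        simp [← galAct_mul, galAct_one]
      map_mul' := fun v w => by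
        ext
        simp }
  map_one' := by
    ext w
    simp [galAct_one]
  map_mul' τ g := by
    ext w
    simp [galAct_mul]

theorem val_groupLikeAct (τ : Gal(L/K)) (w : GroupLike L (L ⊗[K] S.H)) :
    (S.groupLikeAct τ w).val = S.galAct τ w.val := rfl

theorem isBraceDatum : IsBraceDatum S.autEquiv S.groupLikeAct := fun τ g => by
  ext
  rw [GroupLike.val_mul, val_groupLikeAct]
  exact S.autElem_mul τ g

end Fixed

end HopfGaloisStructure

/-! ### Skew braces with cyclic multiplicative group of odd prime power order -/

section CyclicBrace

open Polynomial in
theorem geom_sum_eq_sub_one_pow {p : ℕ} [Fact p.Prime] {R : Type*} [Ring R] [Algebra (ZMod p) R]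
    (x : R) (e : ℕ) : ∑ i ∈ Finset.range (p ^ e), x ^ i = (x - 1) ^ (p ^ e - 1) := by
  have key : ∑ i ∈ Finset.range (p ^ e), (X : (ZMod p)[X]) ^ i = (X - 1) ^ (p ^ e - 1) := by
    have hX : (X - 1 : (ZMod p)[X]) ≠ 0 := by simpa using X_sub_C_ne_zero (1 : ZMod p)
    apply mul_right_cancel₀ hX
    rw [geom_sum_mul, ← pow_succ, Nat.sub_add_cancel (Nat.one_le_pow _ _ (Fact.out : p.Prime).pos),
      sub_pow_char_pow, one_pow]
  have := congrArg (aeval x) key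
  simpa using this

/-- `A` is unipotent, so `(A - 1)^d = 0` with `d = dim V`. If `d ≥ 2`, the geometric sum of length
`p^(d-1)` equals `(A - 1)^(p^(d-1) - 1)` and vanishes. The partial sums are then periodic with
period `p^(d-1)`, too few to reach all `p^d` vectors. -/
theorem eq_one_of_geom_orbit_surjective {p : ℕ} [Fact p.Prime] (hodd : Odd p) {V : Type*}
    [AddCommGroup V] [Module (ZMod p) V] [Finite V] (A : Module.End (ZMod p) V) {m : ℕ}
    (hA : A ^ p ^ m = 1) (b : V)
    (hsurj : ∀ v, ∃ k : ℕ, (∑ i ∈ Finset.range k, A ^ i) b = v) : A = 1 := by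
  have hp : p.Prime := Fact.out
  have : Module.Finite (ZMod p) V := Module.Finite.of_finite
  have hnil : IsNilpotent (A - 1) := by
    refine ⟨p ^ m, ?_⟩
    have : ExpChar (Module.End (ZMod p) V) p ∨ Subsingleton V := by
      rcases subsingleton_or_nontrivial V with h | h
      · exact Or.inr h
      · have : CharP (Module.End (ZMod p) V) p := charP_of_injective_algebraMap
          (algebraMap (ZMod p) (Module.End (ZMod p) V)).injective p
        exact Or.inl (ExpChar.prime hp)
    rcases this with h | h
    · rw [sub_pow_expChar_pow_of_commute _ _ (Commute.one_right A), hA, one_pow, sub_self]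
    · exact Subsingleton.elim _ _
  have hd : (A - 1) ^ Module.finrank (ZMod p) V = 0 := by
    have h := LinearMap.aeval_self_charpoly (A - 1)
    rwa [hnil.charpoly_eq_X_pow_finrank, map_pow, Polynomial.aeval_X] at h
  have hcard : Nat.card V = p ^ Module.finrank (ZMod p) V := by
    rw [Module.natCard_eq_pow_finrank (K := ZMod p), Nat.card_zmod]
  generalize Module.finrank (ZMod p) V = d at hd hcard
  rcases Nat.lt_or_ge d 2 with h2 | h2
  · have : (A - 1) ^ 1 = 0 := pow_eq_zero_of_le (by omega) hd
    rwa [pow_one, sub_eq_zero] at this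
  · exfalso
    obtain ⟨e, rfl⟩ : ∃ e, d = e + 1 := ⟨d - 1, by omega⟩
    -- Equivalently `d ≤ p^e - 1` for `d = e + 1`. This is where `p` odd enters: the bound fails for
    -- `p = 2`, `e = 1`.
    have hq : e + 2 ≤ p ^ e := by
      have h3 : 3 ≤ p := by
        rcases hodd with ⟨k, rfl⟩
        have := hp.two_le
        omega
      refine le_trans ?_ (Nat.pow_le_pow_left h3 e)
      have he : 1 ≤ e := by omega
      clear h2 hd hcard
      induction e, he using Nat.le_induction with
      | base => norm_num
      | succ k hk ih => rw [pow_succ]; omega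
    have hzero : ∑ i ∈ Finset.range (p ^ e), A ^ i = 0 := by
      rw [geom_sum_eq_sub_one_pow (p := p)]
      exact pow_eq_zero_of_le (by omega) hd
    have hper : ∀ k, ∑ i ∈ Finset.range (p ^ e + k), A ^ i = A ^ p ^ e * ∑ i ∈ Finset.range k, A ^ i := by
      intro k
      rw [Finset.sum_range_add, hzero, zero_add, Finset.mul_sum]
      simp only [pow_add]
    have hAq : A ^ p ^ e = 1 := by
      have := geom_sum_mul A (p ^ e)
      rw [hzero, zero_mul] at this
      exact (sub_eq_zero.mp this.symm)
    have hmod : ∀ k, ∃ j < p ^ e, ∑ i ∈ Finset.range k, A ^ i = ∑ i ∈ Finset.range j, A ^ i := by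
      intro k
      induction k using Nat.strong_induction_on with
      | _ k ih =>
        rcases Nat.lt_or_ge k (p ^ e) with hk | hk
        · exact ⟨k, hk, rfl⟩
        · obtain ⟨l, rfl⟩ := Nat.exists_eq_add_of_le hk
          obtain ⟨j, hj, hjl⟩ := ih l (by omega)
          exact ⟨j, hj, by rw [hper, hAq, one_mul, hjl]⟩
    have hs : Function.Surjective fun j : Fin (p ^ e) => (∑ i ∈ Finset.range j, A ^ i) b := by
      intro v
      obtain ⟨k, rfl⟩ := hsurj v
      obtain ⟨j, hj, hjk⟩ := hmod k
      exact ⟨⟨j, hj⟩, by rw [hjk]⟩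
    have := Nat.card_le_card_of_surjective _ hs
    rw [hcard, Nat.card_eq_fintype_card, Fintype.card_fin, Nat.pow_le_pow_iff_right hp.one_lt] at this
    omega

/-- A maximal subgroup of a finite `p`-group is normal, and its quotient is simple and solvable,
hence cyclic of order `p`. It follows that the Frattini quotient is elementary abelian. -/
theorem IsPGroup.coatom_properties {p : ℕ} [Fact p.Prime] {N : Type*} [Group N] [Finite N]
    (hN : IsPGroup p N) {M : Subgroup N} (hM : IsCoatom M) :
    (∀ x, x ^ p ∈ M) ∧ ∀ x y, (y * x)⁻¹ * (x * y) ∈ M := by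
  have : Group.IsNilpotent N := hN.isNilpotent
  have hn : M.Normal := Subgroup.NormalizerCondition.normal_of_coatom M
    Group.normalizerCondition_of_isNilpotent hM
  have hsimple : IsSimpleGroup (N ⧸ M) :=
    { exists_pair_ne := by
        have : Nontrivial (N ⧸ M) := QuotientGroup.nontrivial_iff.mpr hM.1
        exact exists_pair_ne _
      eq_bot_or_eq_top_of_normal := fun H _ => by
        have hle : M ≤ H.comap (QuotientGroup.mk' M) := by
          intro x hx
          rw [Subgroup.mem_comap, QuotientGroup.mk'_apply, (QuotientGroup.eq_one_iff x).mpr hx]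
          exact H.one_mem
        have hmap : (H.comap (QuotientGroup.mk' M)).map (QuotientGroup.mk' M) = H :=
          Subgroup.map_comap_eq_self_of_surjective (QuotientGroup.mk'_surjective M) H
        rcases hle.eq_or_lt with h | h
        · left
          rw [← hmap, ← h]
          exact QuotientGroup.map_mk'_self M
        · right
          rw [← hmap, hM.2 _ h]
          exact Subgroup.map_top_of_surjective _ (QuotientGroup.mk'_surjective M) }
  have hcomm : ∀ x y : N ⧸ M, x * y = y * x :=
    IsSimpleGroup.comm_iff_isSolvable.mpr inferInstance
  have : IsMulCommutative (N ⧸ M) := ⟨⟨hcomm⟩⟩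
  have hprime := IsSimpleGroup.prime_card (α := N ⧸ M)
  have hcard : Nat.card (N ⧸ M) = p := by
    obtain ⟨k, hk⟩ := (hN.to_quotient M).exists_card_eq
    rw [hk] at hprime ⊢
    rw [Nat.Prime.eq_one_of_pow hprime, pow_one]
  refine ⟨fun x => ?_, fun x y => ?_⟩
  · rw [← QuotientGroup.eq_one_iff, QuotientGroup.mk_pow, ← hcard, pow_card_eq_one']
  · rw [← QuotientGroup.eq, QuotientGroup.mk_mul, QuotientGroup.mk_mul, hcomm]

theorem IsPGroup.pow_mem_frattini {p : ℕ} [Fact p.Prime] {N : Type*} [Group N] [Finite N]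
    (hN : IsPGroup p N) (x : N) : x ^ p ∈ frattini N := by
  simp only [frattini, Order.radical, Subgroup.mem_iInf]
  exact fun M hM => (hN.coatom_properties hM).1 x

theorem IsPGroup.commutator_mem_frattini {p : ℕ} [Fact p.Prime] {N : Type*} [Group N] [Finite N]
    (hN : IsPGroup p N) (x y : N) : (y * x)⁻¹ * (x * y) ∈ frattini N := by
  simp only [frattini, Order.radical, Subgroup.mem_iInf]
  exact fun M hM => (hN.coatom_properties hM).2 x y

namespace IsBraceDatum

variable {G N : Type*} [Group G] [Group N] {e : G ≃ N} {a : G →* MulAut N}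
  (h : IsBraceDatum e a)

include h

theorem apply_pow_succ (σ : G) (k : ℕ) : e (σ ^ (k + 1)) = e (σ ^ k) * (a σ ^ k) (e σ) := by
  rw [pow_succ, h, map_pow a]

/-- In an elementary abelian quotient on which `a σ` induces `A`, the image of `e(σ^k)` is the
`k`-th geometric sum of `A` at the image of `e(σ)`. All vectors occur, so `A = 1` and the sum is a
multiple. -/
theorem exists_nsmul_eq_of_elementary {p n : ℕ} (hp : p.Prime) (hodd : Odd p)
    (hG : Nat.card G = p ^ n) {σ : G} (hσ : ∀ g, g ∈ Subgroup.zpowers σ) {V : Type*}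
    [AddCommGroup V] [Module (ZMod p) V] [Finite V] {f : N → V} (hsurj : Function.Surjective f)
    (hf : ∀ μ ν, f (μ * ν) = f μ + f ν) (A : V →+ V) (hA : ∀ ν, A (f ν) = f (a σ ν)) (ν : N) :
    ∃ k : ℕ, f ν = k • f (e σ) := by
  have : Fact p.Prime := ⟨hp⟩
  have hfG : Finite G := Nat.finite_of_card_ne_zero (by rw [hG]; exact (pow_pos hp.pos n).ne')
  obtain ⟨A, rfl⟩ : ∃ B : Module.End (ZMod p) V, B.toAddMonoidHom = A :=
    ⟨AddMonoidHom.toZModLinearMap p A, rfl⟩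
  replace hA : ∀ ν, A (f ν) = f (a σ ν) := hA
  have hAk : ∀ (k : ℕ) ν, (A ^ k) (f ν) = f ((a σ ^ k) ν) := by
    intro k
    induction k with
    | zero => intro ν; rfl
    | succ k ih =>
      intro ν
      rw [pow_succ, pow_succ, Module.End.mul_apply, hA, ih, MulAut.mul_apply]
  have hf1 : f 1 = 0 := by
    have := hf 1 1
    rwa [mul_one, left_eq_add] at this
  have hsum : ∀ k : ℕ, f (e (σ ^ k)) = (∑ i ∈ Finset.range k, A ^ i) (f (e σ)) := by
    intro k
    induction k with
    | zero => simp [hf1, h.apply_one]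
    | succ k ih => rw [Finset.sum_range_succ, LinearMap.add_apply, hAk, ← ih, h.apply_pow_succ, hf]
  have hApow : A ^ p ^ n = 1 := by
    ext v
    obtain ⟨ν, rfl⟩ := hsurj v
    rw [hAk, ← map_pow, ← hG, pow_card_eq_one', map_one a]
    rfl
  have hcyc : ∀ ν, ∃ k : ℕ, ν = e (σ ^ k) := by
    intro ν
    obtain ⟨g, rfl⟩ := e.surjective ν
    obtain ⟨k, hk⟩ := mem_powers_iff_mem_zpowers.mpr (hσ g)
    exact ⟨k, by rw [← hk]⟩
  have hA1 : A = 1 := eq_one_of_geom_orbit_surjective hodd A hApow (f (e σ)) fun v => by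
    obtain ⟨ν, rfl⟩ := hsurj v
    obtain ⟨k, rfl⟩ := hcyc ν
    exact ⟨k, (hsum k).symm⟩
  obtain ⟨k, rfl⟩ := hcyc ν
  refine ⟨k, ?_⟩
  have := hsum k
  rw [hA1] at this
  simp only [one_pow, Finset.sum_const, Finset.card_range, LinearMap.smul_apply,
    Module.End.one_apply] at this
  exact this

theorem zpowers_eq_top {p n : ℕ} (hp : p.Prime) (hodd : Odd p) (hG : Nat.card G = p ^ n) {σ : G}
    (hσ : ∀ g, g ∈ Subgroup.zpowers σ) : Subgroup.zpowers (e σ) = ⊤ := by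
  have : Fact p.Prime := ⟨hp⟩
  have hfG : Finite G := Nat.finite_of_card_ne_zero (by rw [hG]; exact (pow_pos hp.pos n).ne')
  have hfN : Finite N := Finite.of_equiv G e
  have hN : IsPGroup p N := IsPGroup.of_card ((Nat.card_congr e).symm.trans hG)
  let : CommGroup (N ⧸ frattini N) :=
    { (inferInstance : Group (N ⧸ frattini N)) with
      mul_comm := by
        rintro ⟨x⟩ ⟨y⟩
        exact (QuotientGroup.eq.mpr (hN.commutator_mem_frattini x y)).symm }
  -- It now suffices that `e σ` generates `N` modulo the Frattini subgroup.
  apply frattini_nongenerating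
  rw [eq_top_iff]
  intro ν _
  let : Module (ZMod p) (Additive (N ⧸ frattini N)) := AddCommGroup.zmodModule fun x => by
    obtain ⟨y, rfl⟩ := QuotientGroup.mk_surjective x
    exact (QuotientGroup.eq_one_iff _).mpr (hN.pow_mem_frattini y)
  obtain ⟨k, hk⟩ := h.exists_nsmul_eq_of_elementary hp hodd hG hσ
    (V := Additive (N ⧸ frattini N)) (f := fun ν => Additive.ofMul (QuotientGroup.mk ν))
    (QuotientGroup.mk'_surjective (frattini N)) (fun _ _ => rfl)
    (MonoidHom.toAdditive (QuotientGroup.map _ _ (a σ).toMonoidHom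
      (frattini_le_comap_frattini_of_surjective (a σ).surjective))) (fun ν => rfl) ν
  replace hk : (QuotientGroup.mk ν : N ⧸ frattini N) = QuotientGroup.mk (e σ ^ k) := hk
  have h2 : (e σ ^ k)⁻¹ * ν ∈ frattini N := QuotientGroup.eq.mp hk.symm
  rw [← mul_inv_cancel_left (e σ ^ k) ν]
  exact Subgroup.mul_mem_sup (Subgroup.pow_mem _ (Subgroup.mem_zpowers _) k) h2

theorem apply_pow {σ : G} {x : ℕ} (hx : a σ (e σ) = e σ ^ x) (k : ℕ) :
    e (σ ^ k) = e σ ^ ∑ i ∈ Finset.range k, x ^ i := by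
  have hk : ∀ k : ℕ, (a σ ^ k) (e σ) = e σ ^ x ^ k := by
    intro k
    induction k with
    | zero => simp
    | succ k ih => rw [pow_succ, MulAut.mul_apply, hx, map_pow, ih, ← pow_mul, pow_succ]
  induction k with
  | zero => simp [h.apply_one]
  | succ k ih => rw [h.apply_pow_succ, ih, hk, Finset.sum_range_succ, pow_add]

theorem orderOf_apply {p n : ℕ} (hp : p.Prime) (hodd : Odd p) (hG : Nat.card G = p ^ n) {σ : G}
    (hσ : ∀ g, g ∈ Subgroup.zpowers σ) : orderOf (e σ) = p ^ n := by
  rw [← hG, Nat.card_congr e, ← Nat.card_zpowers, h.zpowers_eq_top hp hodd hG hσ, Subgroup.card_top]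

theorem exists_exponent {p n : ℕ} (hp : p.Prime) (hodd : Odd p) (hn : 0 < n)
    (hG : Nat.card G = p ^ n) {σ : G} (hσ : ∀ g, g ∈ Subgroup.zpowers σ) :
    ∃ x : ℕ, x ≡ 1 [MOD p] ∧ a σ (e σ) = e σ ^ x := by
  have : Fact p.Prime := ⟨hp⟩
  have hfG : Finite G := Nat.finite_of_card_ne_zero (by rw [hG]; exact (pow_pos hp.pos n).ne')
  have hfN : Finite N := Finite.of_equiv G e
  have hmem : a σ (e σ) ∈ Subgroup.zpowers (e σ) := by
    rw [h.zpowers_eq_top hp hodd hG hσ]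
    trivial
  obtain ⟨x, hx⟩ := mem_powers_iff_mem_zpowers.mpr hmem
  replace hx : e σ ^ x = a σ (e σ) := hx
  refine ⟨x, ?_, hx.symm⟩
  -- As `σ^(p^n) = 1`, the geometric sum of `x` of length `p^n` is divisible by `p^n`. Modulo `p` it
  -- equals `(x - 1)^(p^n - 1)`, which forces `x ≡ 1`.
  have h1 := h.apply_pow hx.symm (p ^ n)
  rw [← hG, pow_card_eq_one', h.apply_one, hG] at h1
  have h2 := orderOf_dvd_of_pow_eq_one h1.symm
  rw [h.orderOf_apply hp hodd hG hσ] at h2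
  have h3 := (dvd_pow_self p hn.ne').trans h2
  rw [← CharP.cast_eq_zero_iff (ZMod p) p, Nat.cast_sum] at h3
  simp only [Nat.cast_pow] at h3
  rw [geom_sum_eq_sub_one_pow (p := p)] at h3
  rw [← ZMod.natCast_eq_natCast_iff, Nat.cast_one]
  exact sub_eq_zero.mp (IsReduced.eq_zero _ ⟨_, h3⟩)

/-- In both braces `e(σ^k)` is the power of `e(σ)` with exponent `1 + x + ⋯ + x^(k-1)`, and both
generators have order `p^n`. The action of `σ`, read on `G` through `e`, thus depends only on `x`.
-/
theorem act_eq_of_exponent_eq {N' : Type*} [Group N'] {e' : G ≃ N'} {a' : G →* MulAut N'}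
    (h' : IsBraceDatum e' a') {p n : ℕ} (hp : p.Prime) (hodd : Odd p)
    (hG : Nat.card G = p ^ n) {σ : G} (hσ : ∀ g, g ∈ Subgroup.zpowers σ) {x : ℕ}
    (hx : a σ (e σ) = e σ ^ x) (hx' : a' σ (e' σ) = e' σ ^ x) {g g' : G}
    (hg : a σ (e g) = e g') : a' σ (e' g) = e' g' := by
  have hfG : Finite G := Nat.finite_of_card_ne_zero (by rw [hG]; exact (pow_pos hp.pos n).ne')
  obtain ⟨k, rfl⟩ := mem_powers_iff_mem_zpowers.mpr (hσ g)
  obtain ⟨l, rfl⟩ := mem_powers_iff_mem_zpowers.mpr (hσ g')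
  change a σ (e (σ ^ k)) = e (σ ^ l) at hg
  change a' σ (e' (σ ^ k)) = e' (σ ^ l)
  rw [h.apply_pow hx, h.apply_pow hx, map_pow, hx, ← pow_mul, pow_eq_pow_iff_modEq,
    h.orderOf_apply hp hodd hG hσ] at hg
  rw [h'.apply_pow hx', h'.apply_pow hx', map_pow, hx', ← pow_mul, pow_eq_pow_iff_modEq,
    h'.orderOf_apply hp hodd hG hσ]
  exact hg

end IsBraceDatum

end CyclicBrace

/-! ### Classification of Hopf-Galois structures by their exponent -/

namespace HopfGaloisStructure

variable {K : Type u} {L : Type v} [Field K] [Field L] [Algebra K L] [FiniteDimensional K L]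
  [IsGalois K L] (S T : HopfGaloisStructure K L)

theorem eq_sum_autElem (w : L ⊗[K] S.H) :
    w = ∑ g, (galoisBasis K L).repr (S.endEquiv w) g • S.autElem g := by
  apply S.endEquiv.injective
  rw [map_sum]
  simp only [map_smul, endEquiv_autElem]
  conv_lhs => rw [← (galoisBasis K L).sum_repr (S.endEquiv w)]
  simp

/-- `S` has exponent `x` if `σ` acts on the group-like element of `σ` as `x`-th power. -/
def HasExponent (σ : Gal(L/K)) (x : ℕ) : Prop :=
  S.groupLikeAct σ (S.autEquiv σ) = S.autEquiv σ ^ x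

theorem hasExponent_iff {σ : Gal(L/K)} {x : ℕ} :
    S.HasExponent σ x ↔ S.galAct σ (S.autElem σ) = S.autElem σ ^ x := by
  rw [HasExponent, ← GroupLike.val_inj, val_groupLikeAct, GroupLike.val_pow, val_autEquiv]

variable {S T}

theorem HasExponent.congr {σ : Gal(L/K)} {x : ℕ} (h : S.HasExponent σ x)
    (e : isoSetoid K L S T) : T.HasExponent σ x := by
  obtain ⟨φ, hφ⟩ := e
  let Φ : L ⊗[K] S.H →ₐ[K] L ⊗[K] T.H := Algebra.TensorProduct.map (AlgHom.id K L) (φ : S.H →ₐ[K] T.H)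
  have hΦtmul : ∀ c h, Φ (c ⊗ₜ h) = c ⊗ₜ φ h := fun c h => by simp [Φ]
  have hend : ∀ w, T.endEquiv (Φ w) = S.endEquiv w := by
    intro w
    induction w with
    | zero => simp
    | add s t hs ht => rw [map_add, map_add, hs, ht, map_add]
    | tmul c h =>
      ext y
      simp [hΦtmul, hφ]
  have hgal : ∀ w, Φ (S.galAct σ w) = T.galAct σ (Φ w) := by
    intro w
    induction w with
    | zero => simp
    | add s t hs ht => simp only [map_add, hs, ht]
    | tmul c h => simp [hΦtmul]
  have haut : Φ (S.autElem σ) = T.autElem σ := by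
    apply T.endEquiv.injective
    rw [hend, endEquiv_autElem, endEquiv_autElem]
  rw [hasExponent_iff] at h ⊢
  rw [← haut, ← hgal, h, map_pow]

theorem exists_act_eq [CharZero K] {σ : Gal(L/K)} (hσ : ∀ g, g ∈ Subgroup.zpowers σ)
    (h : ∀ g g', S.groupLikeAct σ (S.autEquiv g) = S.autEquiv g' →
      T.groupLikeAct σ (T.autEquiv g) = T.autEquiv g') (k : S.H) :
    ∃ l : T.H, S.act k = T.act l := by
  -- `Θ` matches the group-like elements of each `g`, so by hypothesis it commutes with `σ`. It
  -- therefore carries `1 ⊗ k` to a Galois-fixed element, which comes from `T.H`.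
  let Θ := S.endEquiv.trans T.endEquiv.symm
  have hΘ : ∀ g, Θ (S.autElem g) = T.autElem g := fun g => by simp [Θ, autElem]
  have h' : ∀ g, Θ (S.galAct σ (S.autElem g)) = T.galAct σ (T.autElem g) := by
    intro g
    obtain ⟨g', hg'⟩ := S.autEquiv.surjective (S.groupLikeAct σ (S.autEquiv g))
    have h1 : S.galAct σ (S.autElem g) = S.autElem g' := congrArg GroupLike.val hg'.symm
    have h2 : T.galAct σ (T.autElem g) = T.autElem g' := congrArg GroupLike.val (h g g' hg'.symm)
    rw [h1, h2, hΘ]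
  have hequiv : ∀ w, Θ (S.galAct σ w) = T.galAct σ (Θ w) := by
    intro w
    rw [S.eq_sum_autElem w]
    simp only [map_sum, galAct_smul, map_smul, h', hΘ]
  have hfix : T.galAct σ (Θ (1 ⊗ₜ k)) = Θ (1 ⊗ₜ k) := by
    rw [← hequiv]
    simp
  have hfixpow : ∀ m : ℕ, T.galAct (σ ^ m) (Θ (1 ⊗ₜ k)) = Θ (1 ⊗ₜ k) := by
    intro m
    induction m with
    | zero => rw [pow_zero, galAct_one]
    | succ m ih => rw [pow_succ, galAct_mul, hfix, ih]
  obtain ⟨l, hl⟩ := T.exists_eq_one_tmul (w := Θ (1 ⊗ₜ k)) (fun τ => by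
    obtain ⟨m, rfl⟩ := mem_powers_iff_mem_zpowers.mpr (hσ τ)
    exact hfixpow m)
  refine ⟨l, ?_⟩
  have := congrArg T.endEquiv hl
  simpa [Θ] using this

/-- Both algebras embed in `End_K(L)` with the same image. Counit and coproduct need no separate
matching, since they are determined by the action on 1 and on products. -/
theorem isoSetoid_of_act_eq (h : ∀ k : S.H, ∃ l : T.H, S.act k = T.act l)
    (h' : ∀ l : T.H, ∃ k : S.H, T.act l = S.act k) : isoSetoid K L S T := by
  have hrange : S.act.range = T.act.range := by
    ext f
    constructor
    · rintro ⟨k, rfl⟩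
      obtain ⟨l, hl⟩ := h k
      exact ⟨l, hl.symm⟩
    · rintro ⟨l, rfl⟩
      obtain ⟨k, hk⟩ := h' l
      exact ⟨k, hk.symm⟩
  let φ : S.H ≃ₐ[K] T.H := (AlgEquiv.ofInjective S.act S.injective_act).trans
    ((Subalgebra.equivOfEq _ _ hrange).trans (AlgEquiv.ofInjective T.act T.injective_act).symm)
  have hφ : ∀ k, T.act (φ k) = S.act k := by
    intro k
    have := AlgEquiv.ofInjective_apply T.act T.injective_act (φ k)
    rw [← this]
    simp [φ]
  refine ⟨BialgEquiv.ofAlgEquiv φ ?_ ?_, fun k x => ?_⟩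
  · ext k
    apply (algebraMap K L).injective
    have h1 := T.act_one (φ k)
    have h2 := S.act_one k
    rw [hφ, h2] at h1
    exact h1.symm
  · ext k
    refine T.eq_of_forall_act fun x y => ?_
    have key : ∀ t : S.H ⊗[K] S.H, LinearMap.mul' K L (TensorProduct.map
        (T.act.toLinearMap.flip x) (T.act.toLinearMap.flip y)
        (Algebra.TensorProduct.map (φ : S.H →ₐ[K] T.H) (φ : S.H →ₐ[K] T.H) t)) =
        LinearMap.mul' K L (TensorProduct.map
        (S.act.toLinearMap.flip x) (S.act.toLinearMap.flip y) t) := by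
      intro t
      induction t with
      | zero => simp
      | add s t hs ht => simp only [map_add, hs, ht]
      | tmul k l => simp [hφ]
    refine (key _).trans ?_
    refine (S.act_mul k x y).symm.trans ?_
    rw [← hφ]
    exact T.act_mul (φ k) x y
  · rw [← hφ]
    rfl

theorem isoSetoid_of_hasExponent [CharZero K] {p n : ℕ} (hp : p.Prime) (hodd : Odd p)
    (hG : Nat.card Gal(L/K) = p ^ n) {σ : Gal(L/K)} (hσ : ∀ g, g ∈ Subgroup.zpowers σ) {x : ℕ}
    (hS : S.HasExponent σ x) (hT : T.HasExponent σ x) : isoSetoid K L S T :=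
  isoSetoid_of_act_eq
    (exists_act_eq hσ fun _ _ =>
      S.isBraceDatum.act_eq_of_exponent_eq T.isBraceDatum hp hodd hG hσ hS hT)
    (exists_act_eq hσ fun _ _ =>
      T.isBraceDatum.act_eq_of_exponent_eq S.isBraceDatum hp hodd hG hσ hT hS)

theorem HasExponent.modEq {p n : ℕ} (hp : p.Prime) (hodd : Odd p)
    (hG : Nat.card Gal(L/K) = p ^ n) {σ : Gal(L/K)} (hσ : ∀ g, g ∈ Subgroup.zpowers σ) {x y : ℕ}
    (hx : S.HasExponent σ x) (hy : S.HasExponent σ y) : x ≡ y [MOD p ^ n] := by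
  rw [← S.isBraceDatum.orderOf_apply hp hodd hG hσ, ← pow_eq_pow_iff_modEq]
  exact hx.symm.trans hy

theorem HasExponent.of_modEq {p n : ℕ} (hp : p.Prime) (hodd : Odd p)
    (hG : Nat.card Gal(L/K) = p ^ n) {σ : Gal(L/K)} (hσ : ∀ g, g ∈ Subgroup.zpowers σ) {x y : ℕ}
    (hx : S.HasExponent σ x) (hxy : x ≡ y [MOD p ^ n]) : S.HasExponent σ y := by
  rw [← S.isBraceDatum.orderOf_apply hp hodd hG hσ, ← pow_eq_pow_iff_modEq] at hxy
  exact hx.trans hxy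

end HopfGaloisStructure

theorem IsBraceDatum.hasExponent {K : Type u} {L : Type v} [Field K] [Field L] [Algebra K L]
    [FiniteDimensional K L] [IsGalois K L] [CharZero K] {N : Type v} [Group N]
    {e : Gal(L/K) ≃ N} {a : Gal(L/K) →* MulAut N} (h : IsBraceDatum e a) {σ : Gal(L/K)} {x : ℕ}
    (hx : a σ (e σ) = e σ ^ x) : h.hopfGaloisStructure.HasExponent σ x := by
  rw [HopfGaloisStructure.hasExponent_iff]
  apply (bijective_twistedFixedLift a).1
  have haut : ∀ g, twistedFixedLift a (h.hopfGaloisStructure.autElem g) =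
      MonoidAlgebra.single (e g) 1 := by
    intro g
    apply (braceEnd e).injective
    refine (h.lift_act _).symm.trans ?_
    refine (h.hopfGaloisStructure.endEquiv_autElem g).trans ?_
    simp [braceEnd_single]
  refine (twistedFixedLift_map a σ _).trans ?_
  refine Eq.trans ?_ (map_pow (twistedFixedLift a) (h.hopfGaloisStructure.autElem σ) x).symm
  refine Eq.trans ?_ (congrArg (· ^ x) (haut σ)).symm
  rw [haut, twist_single, hx, MonoidAlgebra.single_pow, map_one, one_pow]

/-! ### The fixed rings `L[α_s(N)]^G` as twisted group algebras -/

section Equivariant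

variable {K : Type u} {L : Type v} [Field K] [Field L] [Algebra K L] {N N' : Type*} [Group N]
  [Group N'] {a : Gal(L/K) →* MulAut N} {a' : Gal(L/K) →* MulAut N'} {f : N →* N'}

theorem mapDomain_twist (h : ∀ g ν, f (a g ν) = a' g (f ν)) (g : Gal(L/K))
    (w : MonoidAlgebra L N) : MonoidAlgebra.mapDomainAlgHom K L f (twist a g w) =
      twist a' g (MonoidAlgebra.mapDomainAlgHom K L f w) := by
  induction w using MonoidAlgebra.induction_linear with
  | zero => simp
  | add x y hx hy => simp only [map_add, hx, hy]
  | single ν d => simp [h]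

theorem map_twistedFixed (hf : Function.Injective f) (h : ∀ g ν, f (a g ν) = a' g (f ν)) :
    (twistedFixed a).map (MonoidAlgebra.mapDomainAlgHom K L f) =
      (MonoidAlgebra.mapDomainAlgHom K L f).range ⊓ twistedFixed a' := by
  have hinj : Function.Injective (MonoidAlgebra.mapDomainAlgHom K L f) :=
    MonoidAlgebra.mapDomain_injective hf
  ext w
  rw [Algebra.mem_inf, mem_twistedFixed, Subalgebra.mem_map]
  constructor
  · rintro ⟨v, hv, rfl⟩
    exact ⟨⟨v, rfl⟩, fun g => by
      rw [← mapDomain_twist h, (mem_twistedFixed a).mp hv g]⟩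
  · rintro ⟨⟨v, rfl⟩, hv⟩
    refine ⟨v, (mem_twistedFixed a).mpr fun g => hinj ?_, rfl⟩
    exact (mapDomain_twist h g v).trans (hv g)

theorem nonempty_twistedFixed_algEquiv (e : N ≃* N') (h : ∀ g ν, e (a g ν) = a' g (e ν)) :
    Nonempty (twistedFixed a ≃ₐ[K] twistedFixed a') := by
  have hinj : Function.Injective (MonoidAlgebra.mapDomainAlgHom K L e.toMonoidHom) :=
    MonoidAlgebra.mapDomain_injective e.injective
  have hmap := map_twistedFixed (f := e.toMonoidHom) e.injective h
  have htop : (MonoidAlgebra.mapDomainAlgHom K L e.toMonoidHom).range = ⊤ := by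
    rw [AlgHom.range_eq_top]
    exact (MonoidAlgebra.domCongr K L e).surjective
  rw [htop, top_inf_eq] at hmap
  exact ⟨((twistedFixed a).equivMapOfInjective _ hinj).trans (Subalgebra.equivOfEq _ _ hmap)⟩

theorem nonempty_twistedFixed_algEquiv_fixedGroupAlgebra {α : N →* Equiv.Perm Gal(L/K)}
    (hα : Function.Injective α)
    (h : ∀ g ν, α (a g ν) = leftRegular Gal(L/K) g * α ν * (leftRegular Gal(L/K) g)⁻¹) :
    Nonempty (twistedFixed a ≃ₐ[K] fixedGroupAlgebra K L α.range) := by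
  have hinj : Function.Injective (MonoidAlgebra.mapDomainAlgHom K L α) :=
    MonoidAlgebra.mapDomain_injective hα
  have hmap := map_twistedFixed (f := α) (a' := MulAut.conj.comp (leftRegular Gal(L/K))) hα h
  have hrange : (MonoidAlgebra.mapDomainAlgHom K L α).range =
      (MonoidAlgebra.mapDomainAlgHom K L α.range.subtype).range := by
    have e : MonoidAlgebra.mapDomainAlgHom K L α =
        (MonoidAlgebra.mapDomainAlgHom K L α.range.subtype).comp
          (MonoidAlgebra.mapDomainAlgHom K L (MonoidHom.ofInjective hα).toMonoidHom) := by
      rw [← MonoidAlgebra.mapDomainAlgHom_comp]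
      rfl
    have hs : Function.Surjective
        (MonoidAlgebra.mapDomainAlgHom K L (MonoidHom.ofInjective hα).toMonoidHom) :=
      (MonoidAlgebra.domCongr K L (MonoidHom.ofInjective hα)).surjective
    rw [e]
    ext w
    constructor
    · rintro ⟨v, rfl⟩
      exact ⟨_, rfl⟩
    · rintro ⟨v, rfl⟩
      obtain ⟨u, rfl⟩ := hs v
      exact ⟨u, rfl⟩
  rw [hrange] at hmap
  exact ⟨((twistedFixed a).equivMapOfInjective _ hinj).trans (Subalgebra.equivOfEq _ _ hmap)⟩

end Equivariant

theorem IsBraceDatum.congr {G N N' : Type*} [Group G] [Group N] [Group N'] {e : G ≃ N}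
    {a : G →* MulAut N} (h : IsBraceDatum e a) (f : N ≃* N') :
    IsBraceDatum (e.trans f.toEquiv) ((MulAut.congr f).toMonoidHom.comp a) := fun τ g => by
  simp [h τ g]

/-! ### The skew braces attached to the powers of `δ`. -/

namespace CyclicChoice

section

variable {p n : ℕ} {G : Type v} {N : Type w} [Group G] [Group N] (D : CyclicChoice p n G N)

include D in
theorem finite_N : Finite N :=
  Nat.finite_of_card_ne_zero (by rw [D.card_N]; exact (pow_pos D.prime.pos n).ne')

include D in
theorem isCyclic_N : IsCyclic N := ⟨D.η, D.η_gen⟩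

theorem mulAut_ext {f g : MulAut N} (h : f D.η = g D.η) : f = g :=
  (MulEquiv.eq_iff_eq_on_generator D.η_gen f g).mpr h

theorem orderOf_θ : orderOf D.θ = p ^ (n - 1) * (p - 1) := by
  have := D.finite_N
  have := D.isCyclic_N
  rw [orderOf_eq_card_of_forall_mem_zpowers D.θ_gen, IsCyclic.card_mulAut, D.card_N,
    Nat.totient_prime_pow D.prime D.pos]

theorem orderOf_δ : orderOf D.δ = p ^ (n - 1) := by
  have h := D.prime.two_le
  rw [δ, orderOf_pow_of_dvd (by omega) (by rw [D.orderOf_θ]; exact dvd_mul_left _ _), D.orderOf_θ,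
    Nat.mul_div_cancel _ (by omega)]

theorem orderOf_δ_pow_dvd (s : ℕ) : orderOf (D.δ ^ s) ∣ orderOf D.σ := by
  refine (orderOf_pow_dvd s).trans ?_
  rw [D.orderOf_δ, D.orderOf_σ]
  exact pow_dvd_pow p (Nat.sub_le n 1)

/-- The action of `G` on `N` by automorphisms for which `σ` acts as `δ ^ s`. -/
noncomputable def action (s : ℕ) : G →* MulAut N :=
  monoidHomOfForallMemZpowers D.σ_gen (D.orderOf_δ_pow_dvd s)

@[simp] theorem action_σ (s : ℕ) : D.action s D.σ = D.δ ^ s :=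
  monoidHomOfForallMemZpowers_apply_gen D.σ_gen (D.orderOf_δ_pow_dvd s)

theorem β_apply_mul (s : ℕ) (g : G) (μ κ : N) :
    D.β s g (μ * κ) = D.action s g μ * D.β s g κ := by
  have : Finite G := Nat.finite_of_card_ne_zero (by
    rw [D.card_G]; exact (pow_pos D.prime.pos n).ne')
  obtain ⟨k, rfl⟩ := mem_powers_iff_mem_zpowers.mpr (D.σ_gen g)
  change D.β s (D.σ ^ k) (μ * κ) = D.action s (D.σ ^ k) μ * D.β s (D.σ ^ k) κ
  induction k generalizing μ κ with
  | zero => simp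
  | succ k ih =>
    have hσ : D.β s D.σ (μ * κ) = D.action s D.σ μ * D.β s D.σ κ := by
      rw [β_σ, action_σ]
      change (D.δ ^ s) (μ * κ) * D.η⁻¹ = (D.δ ^ s) μ * ((D.δ ^ s) κ * D.η⁻¹)
      rw [map_mul, mul_assoc]
    rw [pow_succ, map_mul (D.β s), map_mul (D.action s), Equiv.Perm.mul_apply, hσ, ih,
      Equiv.Perm.mul_apply, MulAut.mul_apply]

/-- The bijection `g ↦ b_s(g)⁻¹` from `G` to `N`. -/
noncomputable def braceEquiv (s : ℕ) : G ≃ N :=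
  (Equiv.ofBijective _ (D.β_bijective s)).trans (Equiv.inv N)

theorem braceEquiv_apply (s : ℕ) (g : G) : D.braceEquiv s g = (D.β s g 1)⁻¹ := rfl

theorem braceEquiv_σ (s : ℕ) : D.braceEquiv s D.σ = D.η := by
  rw [braceEquiv_apply, β_σ]
  change ((D.δ ^ s) 1 * D.η⁻¹)⁻¹ = D.η
  rw [map_one, one_mul, inv_inv]

/-- Since `β_s(σ)` multiplies by `η⁻¹` on the right, `b(τg) = a_τ(b(g)) · b(τ)`. Inversion restores
the order of the factors and sends `σ` to `η`. -/
theorem isBraceDatum (s : ℕ) : IsBraceDatum (D.braceEquiv s) (D.action s) := fun τ g => by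
  simp only [braceEquiv_apply]
  rw [map_mul, Equiv.Perm.mul_apply, ← mul_one (D.β s g 1), β_apply_mul, mul_inv_rev, map_inv,
    mul_one]

theorem injective_α (s : ℕ) : Function.Injective (D.α s) := by
  intro μ ν h
  have h' : leftRegular N μ = leftRegular N ν :=
    (Equiv.ofBijective _ (D.β_bijective s)).symm.permCongrHom.injective h
  simpa [leftRegular] using Equiv.congr_fun h' 1

theorem α_action (s : ℕ) (g : G) (ν : N) :
    D.α s (D.action s g ν) = leftRegular G g * D.α s ν * (leftRegular G g)⁻¹ := by
  rw [eq_mul_inv_iff_mul_eq]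
  set b := Equiv.ofBijective _ (D.β_bijective s) with hb
  have hα : ∀ μ x, b (D.α s μ x) = μ * b x := by
    intro μ x
    change b (b.symm (μ * b.symm.symm x)) = μ * b x
    simp
  have hbm : ∀ x, b (g * x) = D.β s g (b x) := by
    intro x
    change D.β s (g * x) 1 = D.β s g (D.β s x 1)
    rw [map_mul, Equiv.Perm.mul_apply]
  ext x
  apply b.injective
  change b (D.α s (D.action s g ν) (g * x)) = b (g * (D.α s ν x))
  rw [hα, hbm, hbm, hα, β_apply_mul]

theorem exists_δ_pow_eq {x : ℕ} (hx : x ≡ 1 [MOD p]) :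
    ∃ s < p ^ (n - 1), (D.δ ^ s) D.η = D.η ^ x := by
  have := D.finite_N
  have hpos := D.prime.pos
  have hcop : Nat.Coprime (orderOf D.η) x := by
    rw [D.orderOf_η]
    refine Nat.Coprime.pow_left n ?_
    rw [D.prime.coprime_iff_not_dvd]
    intro h
    have h1 : 1 ≡ 0 [MOD p] := hx.symm.trans (Nat.modEq_zero_iff_dvd.mpr h)
    exact D.prime.one_lt.ne' (Nat.dvd_one.mp (Nat.modEq_zero_iff_dvd.mp h1))
  have hord : orderOf D.η = orderOf (D.η ^ x) := hcop.orderOf_pow.symm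
  have hgen : ∀ ν, ν ∈ Subgroup.zpowers (D.η ^ x) := by
    intro ν
    have : Subgroup.zpowers (D.η ^ x) = ⊤ := by
      apply Subgroup.eq_top_of_card_eq
      rw [Nat.card_zpowers, ← hord, D.orderOf_η, D.card_N]
    rw [this]
    trivial
  let f : MulAut N := mulEquivOfOrderOfEq D.η_gen hgen hord
  have hf : f D.η = D.η ^ x := mulEquivOfOrderOfEq_apply_gen ..
  have hfk : ∀ k : ℕ, (f ^ k) D.η = D.η ^ x ^ k := by
    intro k
    induction k with
    | zero => simp
    | succ k ih => rw [pow_succ, MulAut.mul_apply, hf, map_pow, ih, ← pow_mul, pow_succ]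
  -- From `x ≡ 1` modulo `p` follows `x^(p^(n-1)) ≡ 1` modulo `p^n`. Writing `f = θ^j`, the order of
  -- `θ` then forces `p - 1 ∣ j`, so `f` is a power of `δ`.
  have hfp : f ^ p ^ (n - 1) = 1 := by
    apply D.mulAut_ext
    rw [hfk, MulAut.one_apply]
    conv_rhs => rw [← pow_one D.η]
    rw [pow_eq_pow_iff_modEq, D.orderOf_η]
    have h1 : (p : ℤ) ∣ (x : ℤ) - 1 := by
      have := hx.symm.dvd
      simpa using this
    have h2 := dvd_sub_pow_of_dvd_sub h1 (n - 1)
    rw [Nat.sub_add_cancel D.pos, one_pow] at h2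
    refine Nat.ModEq.symm ?_
    rw [Nat.modEq_iff_dvd]
    push_cast
    exact h2
  have hfin : Finite (MulAut N) := inferInstance
  obtain ⟨j, hj⟩ := mem_powers_iff_mem_zpowers.mpr (D.θ_gen f)
  replace hj : D.θ ^ j = f := hj
  rw [← hj, ← pow_mul] at hfp
  have h3 := orderOf_dvd_of_pow_eq_one hfp
  rw [D.orderOf_θ, mul_comm] at h3
  obtain ⟨i, rfl⟩ := Nat.dvd_of_mul_dvd_mul_right (pow_pos hpos (n - 1)) h3
  refine ⟨i % p ^ (n - 1), Nat.mod_lt _ (pow_pos hpos _), ?_⟩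
  rw [← D.orderOf_δ, pow_mod_orderOf, δ, ← pow_mul, hj, hf]

theorem exists_nat_exponent (s : ℕ) : ∃ x : ℕ, (D.δ ^ s) D.η = D.η ^ x := by
  have := D.finite_N
  obtain ⟨x, hx⟩ := mem_powers_iff_mem_zpowers.mpr (D.η_gen ((D.δ ^ s) D.η))
  exact ⟨x, hx.symm⟩

end

section

variable {K : Type u} {L : Type v} [Field K] [Field L] [Algebra K L] {N : Type w} [Group N]
  {p n : ℕ} (D : CyclicChoice p n Gal(L/K) N)

theorem nonempty_twistedFixed_algEquiv_H (s : ℕ) :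
    Nonempty (twistedFixed (D.action s) ≃ₐ[K] D.H s) :=
  nonempty_twistedFixed_algEquiv_fixedGroupAlgebra (D.injective_α s) (D.α_action s)

theorem exists_hopfGaloisStructure [FiniteDimensional K L] [IsGalois K L] [CharZero K] {s x : ℕ}
    (hx : (D.δ ^ s) D.η = D.η ^ x) :
    ∃ T : HopfGaloisStructure K L, T.HasExponent D.σ x ∧ Nonempty (T.H ≃ₐ[K] D.H s) := by
  -- Both groups are cyclic of order `p^n`; carrying the datum over to the Galois group places the
  -- Hopf algebra in the universe of `L`.
  let f : N ≃* Gal(L/K) := mulEquivOfOrderOfEq D.η_gen D.σ_gen (by rw [D.orderOf_η, D.orderOf_σ])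
  have h := (D.isBraceDatum s).congr f
  refine ⟨h.hopfGaloisStructure, h.hasExponent ?_, ?_⟩
  · simp [D.braceEquiv_σ, hx]
  · obtain ⟨e₁⟩ := D.nonempty_twistedFixed_algEquiv_H s
    obtain ⟨e₂⟩ := nonempty_twistedFixed_algEquiv (K := K) (L := L)
      (a := (MulAut.congr f).toMonoidHom.comp (D.action s)) (a' := D.action s) f.symm (fun g ν => by
        simp)
    exact ⟨e₂.trans e₁⟩

end

end CyclicChoice

/-! ### Isomorphism classes of the fixed rings as algebras -/

/-- The two permutations have the same orbits. With a base point `r` in each orbit, `g^i r ↦ h^i r`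
is the conjugating map. It is well defined because `h` is a power of `g`, and injective because `g`
is a power of `h`. -/
theorem Equiv.Perm.exists_semiconj_of_mem_zpowers {X : Type*} [Finite X] {g h : Equiv.Perm X}
    (hg : g ∈ Subgroup.zpowers h) (hh : h ∈ Subgroup.zpowers g) :
    ∃ θ : Equiv.Perm X, ∀ x, θ (g x) = h (θ x) := by
  have aux : ∀ {g h : Equiv.Perm X}, h ∈ Subgroup.zpowers g → ∀ {i j : ℤ} {y : X},
      (g ^ i) y = (g ^ j) y → (h ^ i) y = (h ^ j) y := by
    rintro g h ⟨k, rfl⟩ i j y hy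
    have h1 : (g ^ (i - j)) y = y := by
      rw [sub_eq_neg_add, zpow_add, zpow_neg, Equiv.Perm.mul_apply, hy, Equiv.Perm.inv_def,
        Equiv.symm_apply_apply]
    have h2 := Equiv.Perm.zpow_apply_eq_self_of_apply_eq_self h1 k
    change ((g ^ k) ^ i) y = ((g ^ k) ^ j) y
    rw [← zpow_mul, ← zpow_mul, show k * i = j * k + (i - j) * k by ring, zpow_add, mul_comm k j,
      Equiv.Perm.mul_apply, zpow_mul g (i - j), h2]
  have hsame : ∀ x, ∃ i : ℤ, (g ^ i) (Quotient.out (s := Equiv.Perm.SameCycle.setoid g) ⟦x⟧) = x :=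
    fun x => Quotient.mk_out (s := Equiv.Perm.SameCycle.setoid g) x
  set r : X → X := fun x => Quotient.out (s := Equiv.Perm.SameCycle.setoid g) ⟦x⟧ with hr_def
  choose i hi using hsame
  have hr : ∀ {x y : X}, Equiv.Perm.SameCycle g x y → r x = r y := fun {x y} hxy =>
    congrArg (Quotient.out (s := Equiv.Perm.SameCycle.setoid g)) (Quotient.sound hxy)
  let θ : X → X := fun x => (h ^ i x) (r x)
  have hθ : Function.Injective θ := by
    intro x y hxy
    have hrr : r x = r y := by
      have h1 : Equiv.Perm.SameCycle g (r x) (r y) := by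
        obtain ⟨k, rfl⟩ := hh
        have h2 : ((g ^ k) ^ i x) (r x) = ((g ^ k) ^ i y) (r y) := hxy
        rw [← zpow_mul, ← zpow_mul] at h2
        refine ⟨-(k * i y) + k * i x, ?_⟩
        rw [zpow_add, Equiv.Perm.mul_apply, h2, zpow_neg, Equiv.Perm.inv_def,
          Equiv.symm_apply_apply]
      have h3 : ∀ z, Equiv.Perm.SameCycle g (r z) z := fun z => ⟨i z, hi z⟩
      exact hr ((h3 x).symm.trans (h1.trans (h3 y)))
    have h4 : (h ^ i x) (r x) = (h ^ i y) (r x) := hxy.trans (by rw [hrr])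
    have h5 := aux hg h4
    exact (hi x).symm.trans (h5.trans ((congrArg (g ^ i y) hrr).trans (hi y)))
  refine ⟨Equiv.ofBijective θ (Finite.injective_iff_bijective.mp hθ), fun x => ?_⟩
  change θ (g x) = h (θ x)
  have hrx : r (g x) = r x := hr ⟨-1, by simp⟩
  have h1 : (g ^ i (g x)) (r x) = (g ^ (1 + i x)) (r x) := by
    rw [zpow_add, zpow_one, Equiv.Perm.mul_apply]
    exact (congrArg _ hrx.symm).trans ((hi (g x)).trans (congrArg g (hi x).symm))
  change (h ^ i (g x)) (r (g x)) = h ((h ^ i x) (r x))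
  rw [hrx, aux hh h1, zpow_add, zpow_one, Equiv.Perm.mul_apply]

/-! ### Fourier transform and invariants of the fixed algebra. -/

section Characters

variable {K : Type u} {L : Type v} [Field K] [Field L] [Algebra K L] {N : Type w} [Group N]

variable (L) in
/-- A `K`-valued character as an `L`-valued character. -/
def charExtend (χ : N →* Kˣ) : N →* L :=
  ((algebraMap K L : K →+* L) : K →* L).comp ((Units.coeHom K).comp χ)

@[simp] theorem charExtend_apply (χ : N →* Kˣ) (ν : N) :
    charExtend L χ ν = algebraMap K L (χ ν) := rfl

theorem injective_charExtend : Function.Injective (charExtend L : (N →* Kˣ) → N →* L) := by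
  intro χ ψ h
  ext ν
  exact (algebraMap K L).injective (DFunLike.congr_fun h ν)

variable (K L N) in
/-- The Fourier transform on `L[N]` with respect to `K`-valued characters. -/
noncomputable def charFourier : MonoidAlgebra L N →ₐ[L] ((N →* Kˣ) → L) :=
  AlgHom.pi fun χ => MonoidAlgebra.lift L L N (charExtend L χ)

@[simp] theorem charFourier_single (ν : N) (c : L) (χ : N →* Kˣ) :
    charFourier K L N (MonoidAlgebra.single ν c) χ = c * algebraMap K L (χ ν) := by
  simp [charFourier]

theorem bijective_charFourier [Finite N] (hcard : Nat.card (N →* Kˣ) = Nat.card N) :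
    Function.Bijective (charFourier K L N) := by
  have : Finite (N →* Kˣ) := Nat.finite_of_card_ne_zero (by rw [hcard]; exact Nat.card_pos.ne')
  have := Fintype.ofFinite N
  have := Fintype.ofFinite (N →* Kˣ)
  have hli : LinearIndependent L fun (χ : N →* Kˣ) (ν : N) => charExtend L χ ν :=
    (linearIndependent_monoidHom N L).comp _ injective_charExtend
  have h := (hli.bijective_dotProduct hcard).comp
    (MonoidAlgebra.coeffEquiv.trans Finsupp.equivFunOnFinite).bijective
  convert h using 1
  funext w
  funext χ
  induction w using MonoidAlgebra.induction_linear with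
  | zero => simp
  | add v w hv hw =>
    rw [map_add, Pi.add_apply, hv, hw]
    simp [mul_add, Finset.sum_add_distrib]
  | single ν c =>
    classical
    simp [Finsupp.single_apply, mul_comm]

theorem charFourier_twist (a : Gal(L/K) →* MulAut N) (τ : Gal(L/K)) (w : MonoidAlgebra L N)
    (χ : N →* Kˣ) : charFourier K L N (twist a τ w) χ =
      τ (charFourier K L N w (χ.comp (a τ).toMonoidHom)) := by
  induction w using MonoidAlgebra.induction_linear with
  | zero => simp
  | add v w hv hw => simp only [map_add, Pi.add_apply, hv, hw]
  | single ν c => simp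

theorem mem_twistedFixed_iff_of_generator [Finite Gal(L/K)] (a : Gal(L/K) →* MulAut N)
    {σ : Gal(L/K)} (hσ : ∀ g, g ∈ Subgroup.zpowers σ) {w : MonoidAlgebra L N} :
    w ∈ twistedFixed a ↔ twist a σ w = w := by
  refine ⟨fun h => (mem_twistedFixed a).mp h σ, fun h => (mem_twistedFixed a).mpr fun g => ?_⟩
  obtain ⟨k, rfl⟩ := mem_powers_iff_mem_zpowers.mpr (hσ g)
  change twist a (σ ^ k) w = w
  induction k with
  | zero => rw [pow_zero, twist_one]
  | succ k ih => rw [pow_succ, ← twist_twist, h, ih]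

/-- In Fourier coordinates `w` is fixed when `σ(ŵ(χ ∘ a_σ)) = ŵ(χ)` for all `χ`. A bijection of
characters conjugating one permutation `χ ↦ χ ∘ a_σ` into the other permutes coordinates and
identifies the fixed algebras. It need not respect the group structure of the characters, so in
general only the algebras are matched. -/
theorem nonempty_twistedFixed_algEquiv_of_zpowers [Finite Gal(L/K)] [Finite N]
    (hcard : Nat.card (N →* Kˣ) = Nat.card N) {a a' : Gal(L/K) →* MulAut N} {σ : Gal(L/K)}
    (hσ : ∀ g, g ∈ Subgroup.zpowers σ) (h : a σ ∈ Subgroup.zpowers (a' σ))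
    (h' : a' σ ∈ Subgroup.zpowers (a σ)) : Nonempty (twistedFixed a ≃ₐ[K] twistedFixed a') := by
  have : Finite (N →* Kˣ) := Nat.finite_of_card_ne_zero (by rw [hcard]; exact Nat.card_pos.ne')
  -- Precomposition reverses products, hence the inverse; the permutation `χ ↦ χ ∘ b` is `P b⁻¹`.
  let P : MulAut N →* Equiv.Perm (N →* Kˣ) :=
    { toFun := fun b =>
        { toFun := fun χ => χ.comp (b⁻¹).toMonoidHom
          invFun := fun χ => χ.comp b.toMonoidHom
          left_inv := fun χ => by ext ν; simp
          right_inv := fun χ => by ext ν; simp }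
      map_one' := by ext χ ν; simp
      map_mul' := fun b c => by ext χ ν; simp }
  have hmem : ∀ {b c : MulAut N}, b ∈ Subgroup.zpowers c →
      P b⁻¹ ∈ Subgroup.zpowers (P c⁻¹) := by
    rintro b c ⟨k, rfl⟩
    exact ⟨k, by simp [map_zpow]⟩
  obtain ⟨θ, hθ⟩ := Equiv.Perm.exists_semiconj_of_mem_zpowers (hmem h) (hmem h')
  have hP : ∀ (b : MulAut N) χ, P b⁻¹ χ = χ.comp b.toMonoidHom := fun b χ => by
    ext ν
    simp [P]
  let F := AlgEquiv.ofBijective (charFourier K L N) (bijective_charFourier hcard)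
  let Ξ : MonoidAlgebra L N ≃ₐ[L] MonoidAlgebra L N :=
    (F.trans (AlgEquiv.piCongrLeft' L (fun _ => L) θ.symm)).trans F.symm
  have hΞ : ∀ w χ, charFourier K L N (Ξ w) χ = charFourier K L N w (θ χ) := by
    intro w χ
    have : F (Ξ w) = AlgEquiv.piCongrLeft' L (fun _ => L) θ.symm (F w) := F.apply_symm_apply _
    exact congrFun this χ
  have hiff : ∀ (b : Gal(L/K) →* MulAut N) w, w ∈ twistedFixed b ↔
      ∀ χ, σ (charFourier K L N w (P (b σ)⁻¹ χ)) = charFourier K L N w χ := by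
    intro b w
    rw [mem_twistedFixed_iff_of_generator b hσ, ← (bijective_charFourier (L := L) hcard).1.eq_iff,
      funext_iff]
    simp only [charFourier_twist, hP]
  have hmap : (twistedFixed a').map (Ξ.toAlgHom.restrictScalars K) = twistedFixed a := by
    ext w
    obtain ⟨v, rfl⟩ := Ξ.surjective w
    have h1 : Ξ v ∈ (twistedFixed a').map (Ξ.toAlgHom.restrictScalars K) ↔ v ∈ twistedFixed a' := by
      rw [Subalgebra.mem_map]
      exact ⟨fun ⟨u, hu, huv⟩ => Ξ.injective huv ▸ hu, fun hv => ⟨v, hv, rfl⟩⟩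
    rw [h1, hiff, hiff]
    simp only [hΞ, hθ]
    exact (θ.forall_congr_right (q := fun χ =>
      σ (charFourier K L N v (P (a' σ)⁻¹ χ)) = charFourier K L N v χ)).symm
  exact ⟨(((twistedFixed a').equivMapOfInjective (Ξ.toAlgHom.restrictScalars K) Ξ.injective).trans
    (Subalgebra.equivOfEq _ _ hmap)).symm⟩

/-- A homomorphism on the fixed algebra extends to `L[N]` and is given there by a character with
`τ`-fixed values; if `a τ = 1`, it is compatible with `τ`. Conversely, for an injective `χ` the
extensions of `χ` and `χ ∘ a_τ` agree on the fixed algebra, hence on `L[N]`, so `a_τ = 1`. -/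
theorem act_eq_one_iff [FiniteDimensional K L] [IsGalois K L] (a : Gal(L/K) →* MulAut N)
    (hK : ∀ (χ : N →* L) (τ : Gal(L/K)) (ν : N), τ (χ ν) = χ ν)
    (hfaith : ∃ χ : N →* L, Function.Injective χ) (τ : Gal(L/K)) :
    a τ = 1 ↔ ∀ (f : twistedFixed a →ₐ[K] L) (h : twistedFixed a), τ (f h) = f h := by
  constructor
  · intro ha f h
    let μ := AlgEquiv.ofBijective (twistedFixedLift a) (bijective_twistedFixedLift a)
    let F : MonoidAlgebra L N →ₐ[L] L :=
      (Algebra.TensorProduct.lift (AlgHom.id L L) f (fun _ _ => Commute.all _ _)).comp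
        (μ.symm : MonoidAlgebra L N →ₐ[L] L ⊗[K] twistedFixed a)
    have hF : ∀ h : twistedFixed a, F h = f h := by
      intro h
      have h1 : μ.symm (h : MonoidAlgebra L N) = 1 ⊗ₜ h := by
        rw [AlgEquiv.symm_apply_eq]
        simp [μ]
      simp [F, h1]
    have hτ : ∀ w, τ (F w) = F (twist a τ w) := by
      intro w
      induction w using MonoidAlgebra.induction_linear with
      | zero => simp
      | add v w hv hw => simp only [map_add, hv, hw]
      | single ν c =>
        have h2 : ∀ d : L, F (MonoidAlgebra.single ν d) =
            d * ((F : MonoidAlgebra L N →* L).comp (MonoidAlgebra.of L N)) ν := by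
          intro d
          rw [← mul_one d, ← smul_eq_mul, ← MonoidAlgebra.smul_single, map_smul]
          simp
        rw [twist_single, ha, MulAut.one_apply, h2, h2, map_mul, hK]
    rw [← hF, hτ, (mem_twistedFixed a).mp h.2]
  · intro hf
    obtain ⟨χ, hχ⟩ := hfaith
    let F := MonoidAlgebra.lift L L N χ
    let F' := MonoidAlgebra.lift L L N (χ.comp (a τ).toMonoidHom)
    have h1 : ∀ w, F (twist a τ w) = τ (F' w) := by
      intro w
      induction w using MonoidAlgebra.induction_linear with
      | zero => simp
      | add v w hv hw => simp only [map_add, hv, hw]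
      | single ν c => simp [F, F', hK]
    have h2 : ∀ h : twistedFixed a, F h = F' h := by
      intro h
      apply τ.injective
      rw [← h1, (mem_twistedFixed a).mp h.2]
      exact hf ((F.restrictScalars K).comp (twistedFixed a).val) h
    have h3 : ∀ t, F (twistedFixedLift a t) = F' (twistedFixedLift a t) := by
      intro t
      induction t with
      | zero => simp
      | add s t hs ht => simp only [map_add, hs, ht]
      | tmul c h => rw [twistedFixedLift_tmul, map_smul, map_smul, h2]
    ext ν
    obtain ⟨t, ht⟩ := (bijective_twistedFixedLift a).2 (MonoidAlgebra.single ν 1)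
    have h4 := h3 t
    rw [ht] at h4
    simp only [F, F', MonoidAlgebra.lift_single, one_smul, MonoidHom.comp_apply] at h4
    exact (hχ h4).symm

theorem act_eq_one_iff_of_algEquiv [FiniteDimensional K L] [IsGalois K L]
    {a a' : Gal(L/K) →* MulAut N}
    (hK : ∀ (χ : N →* L) (τ : Gal(L/K)) (ν : N), τ (χ ν) = χ ν)
    (hfaith : ∃ χ : N →* L, Function.Injective χ) (e : twistedFixed a ≃ₐ[K] twistedFixed a')
    (τ : Gal(L/K)) : a τ = 1 ↔ a' τ = 1 := by
  rw [act_eq_one_iff a hK hfaith, act_eq_one_iff a' hK hfaith]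
  constructor
  · intro h f k
    simpa using h (f.comp (e : twistedFixed a →ₐ[K] twistedFixed a')) (e.symm k)
  · intro h f k
    simpa using h (f.comp (e.symm : twistedFixed a' →ₐ[K] twistedFixed a)) (e k)

end Characters

namespace CyclicChoice

variable {K : Type u} {L : Type v} [Field K] [Field L] [Algebra K L] {N : Type w} [Group N]
  {p n : ℕ} (D : CyclicChoice p n Gal(L/K) N)

include D

theorem card_characters (hζ : ∃ ζ : K, IsPrimitiveRoot ζ (p ^ n)) :
    Nat.card (N →* Kˣ) = Nat.card N := by
  have := D.finite_N
  have := D.isCyclic_N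
  have : NeZero (Nat.card N) := ⟨Nat.card_pos.ne'⟩
  have : HasEnoughRootsOfUnity K (Nat.card N) := ⟨by rwa [D.card_N], inferInstance⟩
  let := IsCyclic.commGroup (α := N)
  obtain ⟨e⟩ := IsCyclic.monoidHom_equiv_self N K
  exact Nat.card_congr e.toEquiv

theorem galois_fixes_characters (hζ : ∃ ζ : K, IsPrimitiveRoot ζ (p ^ n)) (χ : N →* L)
    (τ : Gal(L/K)) (ν : N) : τ (χ ν) = χ ν := by
  obtain ⟨ζ, hζ⟩ := hζ
  have : NeZero (p ^ n) := ⟨(pow_pos D.prime.pos n).ne'⟩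
  have hζ' := hζ.map_of_injective (algebraMap K L).injective
  have h1 : χ ν ^ p ^ n = 1 := by rw [← map_pow, ← D.card_N, pow_card_eq_one', map_one]
  obtain ⟨i, -, hi⟩ := hζ'.eq_pow_of_pow_eq_one h1
  rw [← hi, ← map_pow, AlgEquiv.commutes]

theorem exists_injective_character (hζ : ∃ ζ : K, IsPrimitiveRoot ζ (p ^ n)) :
    ∃ χ : N →* L, Function.Injective χ := by
  obtain ⟨ζ, hζ⟩ := hζ
  have hu := hζ.isUnit (pow_pos D.prime.pos n).ne'
  have hord : orderOf hu.unit = p ^ n := by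
    rw [← orderOf_units, IsUnit.unit_spec, hζ.eq_orderOf]
  let χ : N →* Kˣ := monoidHomOfForallMemZpowers D.η_gen (g' := hu.unit)
    (by rw [hord, D.orderOf_η])
  have hχ : χ D.η = hu.unit := monoidHomOfForallMemZpowers_apply_gen ..
  refine ⟨charExtend L χ, ?_⟩
  rw [injective_iff_map_eq_one]
  intro ν hν
  obtain ⟨k, rfl⟩ := Subgroup.mem_zpowers_iff.mp (D.η_gen ν)
  have h1 : χ (D.η ^ k) = 1 := by
    ext
    exact (algebraMap K L).injective (hν.trans (map_one _).symm)
  rw [map_zpow, hχ, ← orderOf_dvd_iff_zpow_eq_one, hord, ← D.orderOf_η,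
    orderOf_dvd_iff_zpow_eq_one] at h1
  exact h1

/-- An isomorphism forces equal kernels of the two actions of `G`, hence equal orders of `δ^r` and
`δ^s`. Equal gcds make each of these a power of the other, by Bézout. -/
theorem nonempty_algEquiv_H_iff [FiniteDimensional K L] [IsGalois K L]
    (hζ : ∃ ζ : K, IsPrimitiveRoot ζ (p ^ n)) (r s : ℕ) :
    Nonempty (D.H r ≃ₐ[K] D.H s) ↔ (p ^ (n - 1)).gcd r = (p ^ (n - 1)).gcd s := by
  have := D.finite_N
  obtain ⟨er⟩ := D.nonempty_twistedFixed_algEquiv_H r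
  obtain ⟨es⟩ := D.nonempty_twistedFixed_algEquiv_H s
  have hord : ∀ s, orderOf (D.δ ^ s) = p ^ (n - 1) / (p ^ (n - 1)).gcd s := fun s => by
    rw [orderOf_pow, D.orderOf_δ]
  constructor
  · rintro ⟨e⟩
    have h := act_eq_one_iff_of_algEquiv (D.galois_fixes_characters hζ)
      (D.exists_injective_character hζ) (er.trans (e.trans es.symm))
    have h1 : ∀ m : ℕ, (D.δ ^ r) ^ m = 1 ↔ (D.δ ^ s) ^ m = 1 := fun m => by
      have := h (D.σ ^ m)
      rwa [map_pow, map_pow, action_σ, action_σ] at this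
    have h2 : orderOf (D.δ ^ r) = orderOf (D.δ ^ s) := Nat.dvd_antisymm
      (orderOf_dvd_of_pow_eq_one ((h1 _).mpr (pow_orderOf_eq_one _)))
      (orderOf_dvd_of_pow_eq_one ((h1 _).mp (pow_orderOf_eq_one _)))
    rw [hord, hord] at h2
    have hp := (pow_pos D.prime.pos (n - 1)).ne'
    rw [← Nat.div_div_self (Nat.gcd_dvd_left (p ^ (n - 1)) r) hp, h2,
      Nat.div_div_self (Nat.gcd_dvd_left (p ^ (n - 1)) s) hp]
  · intro h
    have key : ∀ r s, (p ^ (n - 1)).gcd r ∣ s → D.δ ^ s ∈ Subgroup.zpowers (D.δ ^ r) := by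
      rintro r s ⟨c, rfl⟩
      have h1 : D.δ ^ (p ^ (n - 1)).gcd r ∈ Subgroup.zpowers (D.δ ^ r) := by
        refine ⟨(p ^ (n - 1)).gcdB r, ?_⟩
        change (D.δ ^ r) ^ (p ^ (n - 1)).gcdB r = _
        rw [← zpow_natCast D.δ (Nat.gcd _ _), Nat.gcd_eq_gcd_ab, zpow_add, zpow_mul, zpow_mul,
          zpow_natCast, zpow_natCast, ← D.orderOf_δ, pow_orderOf_eq_one, one_zpow, one_mul]
      rw [pow_mul]
      exact Subgroup.pow_mem _ h1 c
    obtain ⟨e⟩ := nonempty_twistedFixed_algEquiv_of_zpowers (K := K) (L := L)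
      (D.card_characters hζ) (a := D.action r) (a' := D.action s) D.σ_gen
      (by simpa using key s r (h ▸ Nat.gcd_dvd_right _ _))
      (by simpa using key r s (h ▸ Nat.gcd_dvd_right _ _))
    exact ⟨er.symm.trans (e.trans es)⟩

end CyclicChoice

/-! ### Counting -/

/-- Below `p^m` the only multiple of `p^m` is 0, so truncating the valuation at `m` loses nothing.
-/
theorem Nat.Prime.gcd_pow_eq_iff {p m r s : ℕ} (hp : p.Prime) (hr : r < p ^ m) (hs : s < p ^ m) :
    (p ^ m).gcd r = (p ^ m).gcd s ↔ emultiplicity p r = emultiplicity p s := by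
  rw [emultiplicity_eq_emultiplicity_iff]
  constructor
  · have aux : ∀ {r s : ℕ}, r < p ^ m → s < p ^ m → (p ^ m).gcd r = (p ^ m).gcd s →
        ∀ k, p ^ k ∣ r → p ^ k ∣ s := by
      intro r s hr hs h k hk
      rcases le_total k m with hkm | hkm
      · exact (Nat.dvd_gcd (pow_dvd_pow p hkm) hk).trans (h ▸ Nat.gcd_dvd_right _ _)
      · have h0 := Nat.eq_zero_of_dvd_of_lt ((pow_dvd_pow p hkm).trans hk) hr
        rw [h0, Nat.gcd_zero_right] at h
        rw [Nat.eq_zero_of_dvd_of_lt (h ▸ Nat.gcd_dvd_right _ _) hs]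
        exact dvd_zero _
    exact fun h k => ⟨aux hr hs h k, aux hs hr h.symm k⟩
  · have aux : ∀ {r s : ℕ}, (∀ k, p ^ k ∣ r → p ^ k ∣ s) → (p ^ m).gcd r ∣ (p ^ m).gcd s := by
      intro r s h
      obtain ⟨k, -, hk⟩ := (Nat.dvd_prime_pow hp).mp (Nat.gcd_dvd_left (p ^ m) r)
      exact Nat.dvd_gcd (Nat.gcd_dvd_left _ _) (hk ▸ h k (hk ▸ Nat.gcd_dvd_right _ _))
    exact fun h => Nat.dvd_antisymm (aux fun k => (h k).mp) (aux fun k => (h k).mpr)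

namespace CyclicChoice

variable {K : Type u} {L : Type v} [Field K] [Field L] [Algebra K L] {N : Type w} [Group N]
  {p n : ℕ} (D : CyclicChoice p n Gal(L/K) N)

theorem exists_hopfGaloisStructure_transversal [CharZero K] [FiniteDimensional K L]
    [IsGalois K L] :
    ∃ T : ℕ → HopfGaloisStructure K L, (∀ s, Nonempty ((T s).H ≃ₐ[K] D.H s)) ∧
      (∀ S, ∃ s < p ^ (n - 1), HopfGaloisStructure.isoSetoid K L S (T s)) ∧
      ∀ r < p ^ (n - 1), ∀ s < p ^ (n - 1),
        HopfGaloisStructure.isoSetoid K L (T r) (T s) → r = s := by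
  choose x hx using D.exists_nat_exponent
  choose T hT hTH using fun s => D.exists_hopfGaloisStructure (K := K) (L := L) (hx s)
  refine ⟨T, hTH, fun S => ?_, fun r hr s hs h => ?_⟩
  · obtain ⟨y, hy, hS⟩ := S.isBraceDatum.exists_exponent D.prime D.odd D.pos D.card_G D.σ_gen
    obtain ⟨s, hs, hsy⟩ := D.exists_δ_pow_eq hy
    refine ⟨s, hs, HopfGaloisStructure.isoSetoid_of_hasExponent D.prime D.odd D.card_G D.σ_gen
      (x := x s) ?_ (hT s)⟩
    refine HopfGaloisStructure.HasExponent.of_modEq D.prime D.odd D.card_G D.σ_gen (x := y) hS ?_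
    rw [← D.orderOf_η, ← pow_eq_pow_iff_modEq, ← hsy, hx]
  · have h1 := ((hT r).congr h).modEq D.prime D.odd D.card_G D.σ_gen (hT s)
    rw [← D.orderOf_η, ← pow_eq_pow_iff_modEq, ← hx, ← hx] at h1
    exact pow_injOn_Iio_orderOf (by rwa [Set.mem_Iio, D.orderOf_δ])
      (by rwa [Set.mem_Iio, D.orderOf_δ]) (D.mulAut_ext h1)

end CyclicChoice

theorem mainTheorem9 {K : Type u} {L : Type v} {N : Type w} [Field K] [CharZero K] [Field L]
    [Algebra K L] [FiniteDimensional K L] [IsGalois K L] [Group N] (p n : ℕ)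
    (hζ : ∃ ζ : K, IsPrimitiveRoot ζ (p ^ n)) (D : CyclicChoice p n Gal(L/K) N) :
    (∀ r s : ℕ, r < p ^ (n - 1) → s < p ^ (n - 1) →
      (Nonempty (D.H r ≃ₐ[K] D.H s) ↔ emultiplicity p r = emultiplicity p s)) ∧
    Nat.card (Quotient (HopfGaloisStructure.algSetoid K L)) = n ∧
    ∀ v : ℕ, v ≤ n - 1 →
      Nat.card {c : Quotient (HopfGaloisStructure.isoSetoid K L) //
        ∃ S : HopfGaloisStructure K L,
          Quotient.mk (HopfGaloisStructure.isoSetoid K L) S = c ∧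
            Nonempty (S.H ≃ₐ[K] D.H (p ^ v))} = (p ^ (n - 1 - v)).totient := by
  have hH := D.nonempty_algEquiv_H_iff hζ
  have hgcd : ∀ v ≤ n - 1, (p ^ (n - 1)).gcd (p ^ v) = p ^ v := fun v hv =>
    Nat.gcd_eq_right (pow_dvd_pow p hv)
  have hpos := D.pos
  obtain ⟨T, hTH, hsurj, hinj⟩ := D.exists_hopfGaloisStructure_transversal
  have hTT : ∀ r s, Nonempty ((T r).H ≃ₐ[K] (T s).H) ↔
      (p ^ (n - 1)).gcd r = (p ^ (n - 1)).gcd s := fun r s => by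
    obtain ⟨er⟩ := hTH r
    obtain ⟨es⟩ := hTH s
    rw [← hH r s]
    exact ⟨fun ⟨e⟩ => ⟨er.symm.trans (e.trans es)⟩, fun ⟨e⟩ => ⟨er.trans (e.trans es.symm)⟩⟩
  have hiso : ∀ {S S' : HopfGaloisStructure K L}, HopfGaloisStructure.isoSetoid K L S S' →
      Nonempty (S.H ≃ₐ[K] S'.H) := fun ⟨φ, _⟩ => ⟨(φ : _ ≃ₐ[K] _)⟩
  refine ⟨fun r s hr hs => (hH r s).trans (D.prime.gcd_pow_eq_iff hr hs), ?_, fun v hv => ?_⟩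
  · rw [← Nat.card_fin n]
    symm
    -- The representatives are `s = p^v` with `v < n`; the last one, `p^(n-1)`, stands for `s = 0`.
    refine Nat.card_eq_of_bijective
      (fun v : Fin n => Quotient.mk (HopfGaloisStructure.algSetoid K L) (T (p ^ (v : ℕ)))) ⟨?_, ?_⟩
    · intro v w h
      have h1 := (hTT _ _).mp (Quotient.exact h)
      rw [hgcd _ (by omega), hgcd _ (by omega)] at h1
      exact Fin.ext (Nat.pow_right_injective D.prime.two_le h1)
    · intro c
      obtain ⟨S, rfl⟩ := Quotient.exists_rep c
      obtain ⟨s, -, hs⟩ := hsurj S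
      obtain ⟨v, hv, hvs⟩ := (Nat.dvd_prime_pow D.prime).mp (Nat.gcd_dvd_left (p ^ (n - 1)) s)
      refine ⟨⟨v, by omega⟩, Quotient.sound ?_⟩
      obtain ⟨e⟩ := hiso hs
      obtain ⟨e'⟩ := (hTT (p ^ v) s).mpr (by rw [hgcd v hv, hvs])
      exact ⟨e'.trans e.symm⟩
  -- The totient is rewritten as the number of `s < p^(n-1)` with `gcd(p^(n-1), s) = p^v`, which
  -- index the required classes.
  · rw [← Nat.pow_div hv D.prime.pos, Nat.totient_div_of_dvd (pow_dvd_pow p hv),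
      ← Nat.card_eq_finsetCard]
    symm
    refine Nat.card_eq_of_bijective (fun s => ⟨Quotient.mk _ (T s), T s, rfl, ?_⟩) ⟨?_, ?_⟩
    · obtain ⟨e⟩ := hTH s
      obtain ⟨e'⟩ := (hH s (p ^ v)).mpr (by rw [hgcd v hv, (Finset.mem_filter.mp s.2).2])
      exact ⟨e.trans e'⟩
    · rintro ⟨r, hr⟩ ⟨s, hs⟩ h
      rw [Finset.mem_filter, Finset.mem_range] at hr hs
      exact Subtype.ext (hinj r hr.1 s hs.1 (Quotient.exact (congrArg Subtype.val h)))
    · rintro ⟨c, S, rfl, ⟨e⟩⟩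
      obtain ⟨s, hs, hSs⟩ := hsurj S
      obtain ⟨e1⟩ := hiso hSs
      obtain ⟨e2⟩ := hTH s
      have h := (hH s (p ^ v)).mp ⟨e2.symm.trans (e1.symm.trans e)⟩
      rw [hgcd v hv] at h
      exact ⟨⟨s, Finset.mem_filter.mpr ⟨Finset.mem_range.mpr hs, h⟩⟩,
        Subtype.ext (Quotient.sound ((HopfGaloisStructure.isoSetoid K L).symm hSs))⟩
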